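/- For a linear ordering $L$ let $s(x)$ be the immediate successor of $x$ if it exists and $s(x)=x$ otherwise, and let $p(x)$ be the immediate predecessor of $x$ if it exists and $p(x)=x$ otherwise. Call $L$ \emph{sp-homogeneous} if every isomorphism between finitely generated substructures of $(L,\le,s,p)$ extends to an automorphism of $(L,\le,s,p)$, and \emph{weakly sp-homogeneous} if there is a finite set $E\subseteq L$ such that every isomorphism between finitely generated substructures of $(L,\le,s,p)$ that is defined on $E$ and fixes every element of $E$ extends to an automorphism of $(L,\le,s,p)$. Let $\varphi_e$ be the $e$-th partial computable function. If $\varphi_e$ is total and is the characteristic function of (the set of codes of pairs in) a linear ordering relation $\le$ on $\omega$, let $L_e$ be the linear ordering $(\omega,\le)$; otherwise $L_e$ is undefined. Then: 1. $\{e : L_e \text{ is defined and sp-homogeneous}\}$ is $\Pi^0_5$-complete. 2. $\{e : L_e \text{ is defined and weakly sp-homogeneous}\}$ is $\Sigma^0_6$-complete. Here a set of natural numbers is complete for a class $\Gamma$ if it belongs to $\Gamma$ and every set in $\Gamma$ is many-one reducible to it. -/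

import Mathlib

open FirstOrder

noncomputable section

/-! ### Linear orderings with successor and predecessor functions -/

/-- Function symbols: the unary symbols `s` and `p`. -/
inductive SpFunc : ℕ → Type
  | s : SpFunc 1
  | p : SpFunc 1

/-- The language with one binary relation symbol `≤` and two unary function symbols `s`, `p`. -/
def spLang : Language := ⟨SpFunc, Language.orderRel⟩

open Classical in
/-- The immediate successor of `x` if it exists, and `x` otherwise. -/
def spSucc {α : Type*} [LinearOrder α] (x : α) : α :=
  if h : ∃ y, x ⋖ y then h.choose else x

open Classical in
/-- The immediate predecessor of `x` if it exists, and `x` otherwise. -/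
def spPred {α : Type*} [LinearOrder α] (x : α) : α :=
  if h : ∃ y, y ⋖ x then h.choose else x

/-- A linear ordering as a structure `(α, ≤, s, p)`. This is not an instance, because a
substructure carries the restrictions of the ambient `s` and `p`, and not the functions computed
from the induced ordering. -/
abbrev spStructure (α : Type*) [LinearOrder α] : spLang.Structure α where
  funMap
    | SpFunc.s, v => spSucc (v 0)
    | SpFunc.p, v => spPred (v 0)
  RelMap
    | Language.orderRel.le, v => v 0 ≤ v 1

/-- A structure is weakly homogeneous if there is a finite set `E` of elements such that every
isomorphism between finitely generated substructures (equivalently, every embedding of a finitely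
generated substructure `S` into the structure) which is defined on `E` and fixes each element of
`E` extends to an automorphism. -/
def IsWeaklyHomogeneous (L : Language) (M : Type*) [L.Structure M] : Prop :=
  ∃ E : Finset M, ∀ S : L.Substructure M, S.FG → ∀ f : S ↪[L] M,
    (∀ a ∈ E, ∃ h : a ∈ S, f ⟨a, h⟩ = a) →
      ∃ g : M ≃[L] M, f = g.toEmbedding.comp S.subtype

/-- `α` is sp-homogeneous if `(α, ≤, s, p)` is homogeneous: every isomorphism between finitely
generated substructures extends to an automorphism. -/
def IsSpHomogeneous (α : Type*) [LinearOrder α] : Prop :=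
  @Language.IsUltrahomogeneous spLang α (spStructure α)

/-- `α` is weakly sp-homogeneous if `(α, ≤, s, p)` is weakly homogeneous. -/
def IsWeaklySpHomogeneous (α : Type*) [LinearOrder α] : Prop :=
  @IsWeaklyHomogeneous spLang α (spStructure α)

/-! ### Indices of computable linear orderings -/

/-- The `e`-th partial computable function. -/
def phi (e : ℕ) : ℕ →. ℕ :=
  (Denumerable.ofNat Nat.Partrec.Code e).eval

open Classical in
/-- `φ_e` is total and is the characteristic function of the ordering relation `≤` of the linear
ordering `o` with domain `ℕ`. -/
def DefinesLinearOrder (e : ℕ) (o : LinearOrder ℕ) : Prop :=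
  ∀ x y : ℕ, phi e (Nat.pair x y) = Part.some (if o.le x y then 1 else 0)

/-- Indices `e` such that `φ_e` defines a linear ordering `L_e` which is sp-homogeneous. -/
def spHomogeneousIndices : Set ℕ :=
  {e | ∃ o : LinearOrder ℕ, DefinesLinearOrder e o ∧ @IsSpHomogeneous ℕ o}

/-- Indices `e` such that `φ_e` defines a linear ordering `L_e` which is weakly sp-homogeneous. -/
def weaklySpHomogeneousIndices : Set ℕ :=
  {e | ∃ o : LinearOrder ℕ, DefinesLinearOrder e o ∧ @IsWeaklySpHomogeneous ℕ o}

/-! ### The arithmetical hierarchy -/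

/-- `A` is `Σ⁰ₙ`: the computable sets for `n = 0`, and the projections of complements of `Σ⁰ₙ`
sets (that is, of `Π⁰ₙ` sets) for `n + 1`. -/
def IsSigmaZero : ℕ → Set ℕ → Prop
  | 0, A => ComputablePred fun x => x ∈ A
  | n + 1, A => ∃ B : Set ℕ, IsSigmaZero n Bᶜ ∧ A = {x | ∃ y, Nat.pair x y ∈ B}

/-- `A` is `Π⁰ₙ`: its complement is `Σ⁰ₙ`. -/
def IsPiZero (n : ℕ) (A : Set ℕ) : Prop :=
  IsSigmaZero n Aᶜ

/-- `A` is complete for a class `Γ` of sets of natural numbers: it belongs to `Γ`, and every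
member of `Γ` is many-one reducible to it by a total computable function. -/
def IsCompleteFor (Γ : Set ℕ → Prop) (A : Set ℕ) : Prop :=
  Γ A ∧ ∀ B : Set ℕ, Γ B → (fun x => x ∈ B) ≤₀ (fun x => x ∈ A)

end

/-! Upper bounds. By back and forth on a countable order, extending finitely generated partial
isomorphisms to automorphisms is the same as extending them by one point, `SpExt`
(`SpExt.exists_orderIso`). For an order given by an index, covering is Π⁰₁, one step of `s` or `p`
is Π⁰₂, the value of a word in `s` and `p` is Σ⁰₃, and being a partial isomorphism is Π⁰₃. One-point
extension has the form ∀ (Π⁰₃ → ∃ Π⁰₃), hence is Π⁰₅ (`piPred_phiExt`); choosing the fixed finite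
set `E` gives Σ⁰₆.

Lower bounds. Let `T i` be the Σ⁰₄ statement ∃ m, ∀ j, ∃ y, ∀ z, V. One builds, uniformly, an order
consisting of sections 0, 1, 2, … separated by one-point blocks. Section `i` contains finite blocks
of all lengths, densely mixed, and also blocks of type ω exactly when `T i` holds. Its elements are
words with letters `(q, j)`, where `q` runs through a dense order coloured densely. Colour `2 * k`
gives a block of `k + 1` points. Colour `2 * m + 1` tests the witness `m`: after place `j` come the
words with number `n` such that all `y < n` have been refuted at some place up to `j`. If `m` is
correct, every place admits finitely many words and the letter yields a block of type ω. If not, all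
words of the same index are admitted from some place on, and the letter yields a finite block
followed by isolated points and copies of the order of words with that index. This self-similarity
makes a failed test invisible: it adds no new kind of block and no gap (`exists_rootOf_between`).
Admission is c.e., and a c.e. infinite suborder has a computable copy (`exists_index_of_suborder`).

Suppose that `T i` holds infinitely often, which interleaving ensures. If all sections are alike,
the order is a homogeneous mixture of blocks (`spExt_of_shuffle`); if sections of both kinds occur
beyond `E`, moving an interval of one into the other gives a partial isomorphism that does not
extend (`not_spExt`). So homogeneity means ∀ i, `T i`, and weak homogeneity means `T i` for almost
all `i`, the set `E` consisting of finitely many separators. The first form represents every Π⁰₅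
set. For Σ⁰₆ sets the complement is put in the form "infinitely many lists satisfy a Π⁰₄ condition",
by making the witnesses unique (`infinite_setOf_forall_getD_iff`). -/

/-! ### Arithmetical predicates on `Primcodable` types -/

/-- `Σ⁰ₙ` predicates on a `Primcodable` type. -/
def SigmaPred : ℕ → ∀ {α : Type} [Primcodable α], (α → Prop) → Prop
  | 0, _, _, p => ComputablePred p
  | n + 1, α, _, p => ∃ q : α × ℕ → Prop, SigmaPred n (fun x => ¬ q x) ∧ ∀ x, p x ↔ ∃ y, q (x, y)

/-- `Π⁰ₙ` predicates on a `Primcodable` type. -/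
def PiPred (n : ℕ) {α : Type} [Primcodable α] (p : α → Prop) : Prop :=
  SigmaPred n (fun x => ¬ p x)

section ArithmeticalHierarchy

variable {α β : Type} [Primcodable α] [Primcodable β] {n m : ℕ} {p q : α → Prop}

theorem SigmaPred.of_iff (h : SigmaPred n p) (e : ∀ x, q x ↔ p x) : SigmaPred n q := by
  rwa [show q = p from funext fun x => propext (e x)]

theorem PiPred.of_iff (h : PiPred n p) (e : ∀ x, q x ↔ p x) : PiPred n q := by
  rwa [show q = p from funext fun x => propext (e x)]

theorem computablePred_iff_exists_bool :
    ComputablePred p ↔ ∃ f : α → Bool, Computable f ∧ ∀ a, p a ↔ f a = true := by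
  constructor
  · rintro ⟨_, h⟩
    exact ⟨_, h, fun a => by simp⟩
  · rintro ⟨f, hf, h⟩
    refine ⟨fun a => decidable_of_iff _ (h a).symm, hf.of_eq fun a => ?_⟩
    rw [Bool.eq_iff_iff]
    simp [h]

theorem SigmaPred.not (h : PiPred n p) : SigmaPred n (fun x => ¬ p x) := h

theorem PiPred.not (h : SigmaPred n p) : PiPred n (fun x => ¬ p x) := by
  unfold PiPred
  simpa using h

theorem SigmaPred.comp {p : β → Prop} (h : SigmaPred n p) {f : α → β} (hf : Computable f) :
    SigmaPred n (fun a => p (f a)) := by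
  induction n generalizing α β with
  | zero =>
    obtain ⟨g, hg, e⟩ := computablePred_iff_exists_bool.1 h
    exact computablePred_iff_exists_bool.2 ⟨_, hg.comp hf, fun a => e _⟩
  | succ n ih =>
    obtain ⟨q, hq, e⟩ := h
    exact ⟨fun x => q (f x.1, x.2),
      ih hq ((hf.comp Computable.fst).pair Computable.snd), fun x => e _⟩

theorem PiPred.comp {p : β → Prop} (h : PiPred n p) {f : α → β} (hf : Computable f) :
    PiPred n (fun a => p (f a)) :=
  SigmaPred.comp (p := fun x => ¬ p x) h hf

theorem PiPred.toSigma_succ (h : PiPred n p) : SigmaPred (n + 1) p :=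
  ⟨fun x => p x.1, h.comp Computable.fst, fun _ => by simp⟩

theorem SigmaPred.toPi_succ (h : SigmaPred n p) : PiPred (n + 1) p :=
  (PiPred.not h).toSigma_succ

theorem SigmaPred.succ (h : SigmaPred n p) : SigmaPred (n + 1) p := by
  induction n generalizing α with
  | zero => exact PiPred.toSigma_succ (ComputablePred.not h)
  | succ n ih =>
    obtain ⟨q, hq, e⟩ := h
    exact ⟨q, ih hq, e⟩

theorem SigmaPred.mono (h : SigmaPred n p) (hnm : n ≤ m) : SigmaPred m p := by
  induction hnm with
  | refl => exact h
  | step _ ih => exact ih.succ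

theorem PiPred.mono (h : PiPred n p) (hnm : n ≤ m) : PiPred m p := SigmaPred.mono h hnm

theorem SigmaPred.toPi (h : SigmaPred n p) (hnm : n < m) : PiPred m p := h.toPi_succ.mono hnm

theorem PiPred.toSigma (h : PiPred n p) (hnm : n < m) : SigmaPred m p := h.toSigma_succ.mono hnm

/-- The two closures are proved together because the inductive step passes to complements, which
exchanges conjunction and disjunction. -/
theorem SigmaPred.and_or (hp : SigmaPred n p) (hq : SigmaPred n q) :
    SigmaPred n (fun x => p x ∧ q x) ∧ SigmaPred n (fun x => p x ∨ q x) := by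
  induction n generalizing α with
  | zero =>
    obtain ⟨f, hf, e⟩ := computablePred_iff_exists_bool.1 hp
    obtain ⟨g, hg, e'⟩ := computablePred_iff_exists_bool.1 hq
    exact ⟨computablePred_iff_exists_bool.2 ⟨_, Primrec.and.to_comp.comp hf hg, by simp [e, e']⟩,
      computablePred_iff_exists_bool.2 ⟨_, Primrec.or.to_comp.comp hf hg, by simp [e, e']⟩⟩
  | succ n ih =>
    obtain ⟨r, hr, e⟩ := hp
    obtain ⟨s, hs, e'⟩ := hq
    have hu : Computable fun x : α × ℕ => x.2.unpair :=
      Primrec.unpair.to_comp.comp Computable.snd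
    constructor
    · refine ⟨fun x => r (x.1, x.2.unpair.1) ∧ s (x.1, x.2.unpair.2), ?_, fun x => ?_⟩
      · refine SigmaPred.of_iff (ih (SigmaPred.comp hr
          (Computable.fst.pair (Computable.fst.comp hu))) (SigmaPred.comp hs
          (Computable.fst.pair (Computable.snd.comp hu)))).2 fun x => ?_
        tauto
      · show p x ∧ q x ↔ _
        rw [e, e']
        constructor
        · rintro ⟨⟨y, hy⟩, z, hz⟩
          exact ⟨Nat.pair y z, by simpa using ⟨hy, hz⟩⟩
        · rintro ⟨y, hy⟩
          exact ⟨⟨_, hy.1⟩, _, hy.2⟩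
    · refine ⟨fun x => r x ∨ s x, (ih hr hs).1.of_iff fun x => by tauto, fun x => ?_⟩
      show p x ∨ q x ↔ _
      rw [e, e', exists_or]

theorem SigmaPred.and (hp : SigmaPred n p) (hq : SigmaPred n q) :
    SigmaPred n (fun x => p x ∧ q x) := (hp.and_or hq).1

theorem SigmaPred.or (hp : SigmaPred n p) (hq : SigmaPred n q) :
    SigmaPred n (fun x => p x ∨ q x) := (hp.and_or hq).2

theorem PiPred.and (hp : PiPred n p) (hq : PiPred n q) : PiPred n (fun x => p x ∧ q x) :=
  (SigmaPred.or hp hq).of_iff fun _ => by tauto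

theorem PiPred.or (hp : PiPred n p) (hq : PiPred n q) : PiPred n (fun x => p x ∨ q x) :=
  (SigmaPred.and hp hq).of_iff fun _ => by tauto

theorem SigmaPred.imp (hp : PiPred n p) (hq : SigmaPred n q) :
    SigmaPred n (fun x => p x → q x) :=
  (SigmaPred.or hp hq).of_iff fun _ => by tauto

theorem PiPred.imp (hp : SigmaPred n p) (hq : PiPred n q) :
    PiPred n (fun x => p x → q x) :=
  ((PiPred.not hp).or hq).of_iff fun _ => by tauto

theorem SigmaPred.exists_nat {p : α → ℕ → Prop}
    (h : SigmaPred (n + 1) fun x : α × ℕ => p x.1 x.2) :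
    SigmaPred (n + 1) fun a => ∃ y, p a y := by
  obtain ⟨q, hq, e⟩ := h
  have hu : Computable fun x : α × ℕ => x.2.unpair :=
    Primrec.unpair.to_comp.comp Computable.snd
  refine ⟨fun x => q ((x.1, x.2.unpair.1), x.2.unpair.2), SigmaPred.comp hq
    ((Computable.fst.pair (Computable.fst.comp hu)).pair (Computable.snd.comp hu)), fun x => ?_⟩
  constructor
  · rintro ⟨y, hy⟩
    obtain ⟨z, hz⟩ := (e (x, y)).1 hy
    exact ⟨Nat.pair y z, by simpa using hz⟩
  · rintro ⟨y, hy⟩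
    exact ⟨_, (e (x, _)).2 ⟨_, hy⟩⟩

/-- Numbers that decode to nothing are sent to `default`, which is still an element of `β`, so
quantifying over codes adds no witness. -/
theorem SigmaPred.ex [Inhabited β] {p : α → β → Prop}
    (h : SigmaPred (n + 1) fun x : α × β => p x.1 x.2) :
    SigmaPred (n + 1) fun a => ∃ b, p a b := by
  have hd : Computable fun x : α × ℕ => (Encodable.decode (α := β) x.2).getD default :=
    Primrec.option_getD_default.to_comp.comp (Computable.decode.comp Computable.snd)
  refine (SigmaPred.exists_nat (p := fun a y => p a ((Encodable.decode (α := β) y).getD default))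
    (h.comp (Computable.fst.pair hd))).of_iff fun a => ?_
  constructor
  · rintro ⟨b, hb⟩
    exact ⟨Encodable.encode b, by simpa using hb⟩
  · rintro ⟨y, hy⟩
    exact ⟨_, hy⟩

theorem PiPred.all [Inhabited β] {p : α → β → Prop}
    (h : PiPred (n + 1) fun x : α × β => p x.1 x.2) :
    PiPred (n + 1) fun a => ∀ b, p a b :=
  (SigmaPred.ex (p := fun a b => ¬ p a b) h).of_iff fun _ => by simp

theorem ComputablePred.sigma (h : ComputablePred p) : SigmaPred n p :=
  SigmaPred.mono (n := 0) h (Nat.zero_le n)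

theorem ComputablePred.pi (h : ComputablePred p) : PiPred n p :=
  SigmaPred.mono (n := 0) (ComputablePred.not h) (Nat.zero_le n)

theorem ComputablePred.and (hp : ComputablePred p) (hq : ComputablePred q) :
    ComputablePred fun x => p x ∧ q x := SigmaPred.and (n := 0) hp hq

theorem ComputablePred.or (hp : ComputablePred p) (hq : ComputablePred q) :
    ComputablePred fun x => p x ∨ q x := SigmaPred.or (n := 0) hp hq

theorem ComputablePred.comp {p : β → Prop} (hp : ComputablePred p) {f : α → β}
    (hf : Computable f) : ComputablePred fun x => p (f x) := SigmaPred.comp (n := 0) hp hf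

theorem ComputablePred.ball_lt {p : α → ℕ → Prop} (h : ComputablePred fun x : α × ℕ => p x.1 x.2) :
    ComputablePred fun x : α × ℕ => ∀ t < x.2, p x.1 t := by
  obtain ⟨f, hf, e⟩ := computablePred_iff_exists_bool.1 h
  have hrec := Computable.nat_rec (α := α × ℕ) (σ := Bool) (f := fun x => x.2) (g := fun _ => true)
    (h := fun x y => y.2 && f (x.1, y.1)) Computable.snd (Computable.const true)
    (Primrec.and.to_comp.comp (Computable.snd.comp Computable.snd)
      (hf.comp ((Computable.fst.comp Computable.fst).pair (Computable.fst.comp Computable.snd))))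
  refine computablePred_iff_exists_bool.2 ⟨_, hrec, ?_⟩
  rintro ⟨a, k⟩
  induction k with
  | zero => simp
  | succ k ih =>
    have := e (a, k)
    simp only [Nat.lt_succ_iff_lt_or_eq, Bool.and_eq_true] at ih ⊢
    rw [← ih, ← this]
    constructor
    · exact fun H => ⟨fun t ht => H t (Or.inl ht), H k (Or.inr rfl)⟩
    · rintro ⟨H, H'⟩ t (ht | rfl)
      exacts [H t ht, H']

/-- The finitely many witnesses can be collected in one list, which brings the existential
quantifier to the front. -/
theorem SigmaPred.ball_lt {p : α → ℕ → Prop} (h : SigmaPred 1 fun x : α × ℕ => p x.1 x.2) :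
    SigmaPred 1 fun x : α × ℕ => ∀ t < x.2, p x.1 t := by
  obtain ⟨q, hq, e⟩ := h
  replace hq : ComputablePred q := by simpa using ComputablePred.not hq
  have hget : Computable fun y : (α × List ℕ) × ℕ => y.1.2.getD y.2 0 :=
    (Primrec.list_getD (α := ℕ) 0).to_comp.comp (Computable.snd.comp Computable.fst) Computable.snd
  have h1 := ComputablePred.ball_lt (α := α × List ℕ)
    (p := fun y t => q ((y.1, t), y.2.getD t 0))
    (hq.comp (((Computable.fst.comp Computable.fst).pair Computable.snd).pair hget))
  have h2 : ComputablePred fun y : (α × ℕ) × List ℕ =>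
      ∀ t < y.1.2, q ((y.1.1, t), y.2.getD t 0) :=
    h1.comp (f := fun y : (α × ℕ) × List ℕ => ((y.1.1, y.2), y.1.2))
      (((Computable.fst.comp Computable.fst).pair Computable.snd).pair
        (Computable.snd.comp Computable.fst))
  refine (SigmaPred.ex (n := 0) (p := fun (x : α × ℕ) (l : List ℕ) =>
    ∀ t < x.2, q ((x.1, t), l.getD t 0)) h2.sigma).of_iff ?_
  rintro ⟨a, k⟩
  constructor
  · intro H
    choose! f hf using fun t ht => (e (a, t)).1 (H t ht)
    refine ⟨(List.range k).map f, fun t ht => ?_⟩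
    simpa [List.getD, ht] using hf t ht
  · rintro ⟨l, hl⟩ t ht
    exact (e (a, t)).2 ⟨_, hl t ht⟩

end ArithmeticalHierarchy

theorem isSigmaZero_iff {n : ℕ} {A : Set ℕ} : IsSigmaZero n A ↔ SigmaPred n (fun x => x ∈ A) := by
  induction n generalizing A with
  | zero => rfl
  | succ n ih =>
    constructor
    · rintro ⟨B, hB, rfl⟩
      exact ⟨fun x => Nat.pair x.1 x.2 ∈ B,
        SigmaPred.comp (ih.1 hB) Primrec₂.natPair.to_comp, fun x => Iff.rfl⟩
    · rintro ⟨q, hq, e⟩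
      refine ⟨{x | q x.unpair}, ih.2 (SigmaPred.comp hq Primrec.unpair.to_comp), ?_⟩
      ext x
      simpa using e x

theorem isPiZero_iff {n : ℕ} {A : Set ℕ} : IsPiZero n A ↔ PiPred n (fun x => x ∈ A) :=
  isSigmaZero_iff

/-! ### The functions `s` and `p` -/

section SuccPred

variable {α β : Type*} [LinearOrder α] [LinearOrder β]

theorem spSucc_eq_of_covBy {x y : α} (h : x ⋖ y) : spSucc x = y := by
  have h' : ∃ y, x ⋖ y := ⟨y, h⟩
  rw [spSucc, dif_pos h']
  exact h'.choose_spec.unique_right h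

theorem spPred_eq_of_covBy {x y : α} (h : y ⋖ x) : spPred x = y := by
  have h' : ∃ y, y ⋖ x := ⟨y, h⟩
  rw [spPred, dif_pos h']
  exact h'.choose_spec.unique_left h

theorem spSucc_eq_self {x : α} (h : ¬ ∃ y, x ⋖ y) : spSucc x = x := dif_neg h

theorem spPred_eq_self {x : α} (h : ¬ ∃ y, y ⋖ x) : spPred x = x := dif_neg h

theorem spSucc_eq_iff {x y : α} : spSucc x = y ↔ x ⋖ y ∨ x = y ∧ ∀ z, ¬ x ⋖ z := by
  by_cases h : ∃ z, x ⋖ z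
  · obtain ⟨z, hz⟩ := h
    rw [spSucc_eq_of_covBy hz]
    refine ⟨fun e => Or.inl (e ▸ hz), ?_⟩
    rintro (h | ⟨-, h⟩)
    exacts [hz.unique_right h, absurd hz (h z)]
  · rw [spSucc_eq_self h]
    refine ⟨fun e => Or.inr ⟨e, not_exists.1 h⟩, ?_⟩
    rintro (h' | ⟨h', -⟩)
    exacts [absurd ⟨y, h'⟩ h, h']

theorem spPred_eq_iff {x y : α} : spPred x = y ↔ y ⋖ x ∨ x = y ∧ ∀ z, ¬ z ⋖ x := by
  by_cases h : ∃ z, z ⋖ x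
  · obtain ⟨z, hz⟩ := h
    rw [spPred_eq_of_covBy hz]
    refine ⟨fun e => Or.inl (e ▸ hz), ?_⟩
    rintro (h | ⟨-, h⟩)
    exacts [hz.unique_left h, absurd hz (h z)]
  · rw [spPred_eq_self h]
    refine ⟨fun e => Or.inr ⟨e, not_exists.1 h⟩, ?_⟩
    rintro (h' | ⟨h', -⟩)
    exacts [absurd ⟨y, h'⟩ h, h']

theorem OrderIso.map_spSucc (e : α ≃o β) (x : α) : e (spSucc x) = spSucc (e x) := by
  symm
  rw [spSucc_eq_iff, apply_covBy_apply_iff, e.apply_eq_iff_eq]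
  rcases spSucc_eq_iff.1 (rfl : spSucc x = spSucc x) with h | ⟨h, h'⟩
  · exact Or.inl h
  · refine Or.inr ⟨h, fun z hz => h' (e.symm z) ?_⟩
    rwa [← apply_covBy_apply_iff e, e.apply_symm_apply]

theorem OrderIso.map_spPred (e : α ≃o β) (x : α) : e (spPred x) = spPred (e x) := by
  symm
  rw [spPred_eq_iff, apply_covBy_apply_iff, e.apply_eq_iff_eq]
  rcases spPred_eq_iff.1 (rfl : spPred x = spPred x) with h | ⟨h, h'⟩
  · exact Or.inl h
  · refine Or.inr ⟨h, fun z hz => h' (e.symm z) ?_⟩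
    rwa [← apply_covBy_apply_iff e, e.apply_symm_apply]

/-- One of the functions `s` (`true`) and `p` (`false`). -/
noncomputable def spStep (b : Bool) (x : α) : α := bif b then spSucc x else spPred x

/-- The value of a word in `s` and `p` at `x`, the letters being applied from left to right. -/
noncomputable def spAct (x : α) (w : List Bool) : α := w.foldl (fun y b => spStep b y) x

@[simp] theorem spAct_nil (x : α) : spAct x [] = x := rfl

theorem spAct_cons (x : α) (b : Bool) (w : List Bool) :
    spAct x (b :: w) = spAct (spStep b x) w := rfl

theorem spAct_append (x : α) (w w' : List Bool) : spAct x (w ++ w') = spAct (spAct x w) w' :=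
  List.foldl_append

theorem OrderIso.map_spStep (e : α ≃o β) (b : Bool) (x : α) :
    e (spStep b x) = spStep b (e x) := by
  cases b
  exacts [e.map_spPred x, e.map_spSucc x]

theorem OrderIso.map_spAct (e : α ≃o β) (x : α) (w : List Bool) :
    e (spAct x w) = spAct (e x) w := by
  induction w generalizing x with
  | nil => rfl
  | cons b w ih => rw [spAct_cons, ih, e.map_spStep, spAct_cons]

/-- The finite relation `l` generates an isomorphism between substructures of `(α, ≤, s, p)`. -/
def SpIso (l : List (α × α)) : Prop :=
  ∀ u ∈ l, ∀ v ∈ l, ∀ w w' : List Bool,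
    spAct u.1 w ≤ spAct v.1 w' ↔ spAct u.2 w ≤ spAct v.2 w'

/-- Every finitely generated partial isomorphism fixing `E` can be extended by one point. -/
def SpExt (E : Set α) : Prop :=
  ∀ l : List (α × α), (∀ e ∈ E, (e, e) ∈ l) → SpIso l → ∀ c, ∃ d, SpIso ((c, d) :: l)

theorem SpIso.swap {l : List (α × α)} (h : SpIso l) : SpIso (l.map Prod.swap) := by
  intro u hu v hv w w'
  simp only [List.mem_map] at hu hv
  obtain ⟨u, hu, rfl⟩ := hu
  obtain ⟨v, hv, rfl⟩ := hv
  exact (h u hu v hv w w').symm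

theorem SpIso.eq_iff {l : List (α × α)} (h : SpIso l) {u v : α × α} (hu : u ∈ l) (hv : v ∈ l)
    (w w' : List Bool) : spAct u.1 w = spAct v.1 w' ↔ spAct u.2 w = spAct v.2 w' := by
  simp only [le_antisymm_iff, h u hu v hv, h v hv u hu]

theorem SpIso.lt_iff {l : List (α × α)} (h : SpIso l) {u v : α × α} (hu : u ∈ l) (hv : v ∈ l) :
    u.1 < v.1 ↔ u.2 < v.2 := by
  simpa using not_congr (h v hv u hu [] [])

theorem SpIso.map_orderIso (e : α ≃o β) {l : List (α × α)} (h : SpIso l) :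
    SpIso (l.map (Prod.map e e)) := by
  intro u hu v hv w w'
  simp only [List.mem_map] at hu hv
  obtain ⟨u, hu, rfl⟩ := hu
  obtain ⟨v, hv, rfl⟩ := hv
  simp only [Prod.map_fst, Prod.map_snd, ← e.map_spAct, e.le_iff_le]
  exact h u hu v hv w w'

theorem SpExt.map_orderIso (e : α ≃o β) {E : Set α} (h : SpExt E) : SpExt (e '' E) := by
  intro l hl hiso c
  have hid : (l.map (Prod.map e.symm e.symm)).map (Prod.map e e) = l := by
    rw [List.map_map]
    exact (List.map_congr_left fun u _ => by simp [Prod.map]).trans (List.map_id l)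
  have hE : ∀ a ∈ E, (a, a) ∈ l.map (Prod.map e.symm e.symm) := fun a ha =>
    List.mem_map.2 ⟨(e a, e a), hl _ ⟨a, ha, rfl⟩, by simp⟩
  obtain ⟨d, hd⟩ := h (l.map (Prod.map e.symm e.symm)) hE (hiso.map_orderIso e.symm) (e.symm c)
  refine ⟨e d, ?_⟩
  have := hd.map_orderIso e
  rw [List.map_cons, hid] at this
  simpa using this

/-- A finite partial isomorphism of `(α, ≤, s, p)` fixing `E`. -/
structure SpPartialIso (E : Set α) where
  graph : List (α × α)
  fixes : ∀ e ∈ E, (e, e) ∈ graph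
  isIso : SpIso graph

instance (E : Set α) : Preorder (SpPartialIso E) where
  le s t := s.graph ⊆ t.graph
  le_refl _ := List.Subset.refl _
  le_trans _ _ _ := List.Subset.trans

/-- A finite partial isomorphism extends to an automorphism, by back and forth. -/
theorem SpExt.exists_orderIso [Countable α] {E : Set α} (h : SpExt E) {l : List (α × α)}
    (hE : ∀ e ∈ E, (e, e) ∈ l) (hl : SpIso l) : ∃ g : α ≃o α, ∀ u ∈ l, g u.1 = u.2 := by
  have := Encodable.ofCountable α
  let P := SpPartialIso E
  have hle : ∀ {s t : P}, s ≤ t → s.graph ⊆ t.graph := id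
  -- One requirement per point and side: `inl` puts the point into the domain, `inr` into the range.
  -- The second follows from the first by swapping, since the pairs `(e, e)` are invariant.
  let D : α ⊕ α → Order.Cofinal P := fun c =>
    { carrier := {s | c.elim (fun a => ∃ b, (a, b) ∈ s.graph) (fun a => ∃ b, (b, a) ∈ s.graph)}
      isCofinal := by
        rintro ⟨s, hs, hs'⟩
        rcases c with c | c
        · obtain ⟨d, hd⟩ := h s hs hs' c
          exact ⟨⟨(c, d) :: s, fun e he => List.mem_cons_of_mem _ (hs e he), hd⟩,
            ⟨d, List.mem_cons_self⟩, List.subset_cons_self _ _⟩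
        · obtain ⟨d, hd⟩ := h (s.map Prod.swap)
            (fun e he => List.mem_map.2 ⟨_, hs e he, rfl⟩) hs'.swap c
          have := hd.swap
          rw [List.map_cons, List.map_map, Prod.swap_swap_eq, List.map_id] at this
          exact ⟨⟨(d, c) :: s, fun e he => List.mem_cons_of_mem _ (hs e he), this⟩,
            ⟨d, List.mem_cons_self⟩, List.subset_cons_self _ _⟩ }
  let I := Order.idealOfCofinals (⟨l, hE, hl⟩ : P) D
  -- Any two members of the ideal have a common extension, so two pairs can always be compared
  -- inside one partial isomorphism.
  have hdir : ∀ s ∈ I, ∀ t ∈ I, ∀ u ∈ s.graph, ∀ v ∈ t.graph, u.1 ≤ v.1 ↔ u.2 ≤ v.2 := by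
    intro s hs t ht u hu v hv
    obtain ⟨r, hr, hsr, htr⟩ := I.directed s hs t ht
    simpa using r.isIso u (hle hsr hu) v (hle htr hv) [] []
  have hF : ∀ a, ∃ b, ∃ s ∈ I, (a, b) ∈ s.graph := by
    intro a
    obtain ⟨s, ⟨b, hb⟩, hs⟩ := Order.cofinal_meets_idealOfCofinals (⟨l, hE, hl⟩ : P) D (Sum.inl a)
    exact ⟨b, s, hs, hb⟩
  have hG : ∀ a, ∃ b, ∃ s ∈ I, (b, a) ∈ s.graph := by
    intro a
    obtain ⟨s, ⟨b, hb⟩, hs⟩ := Order.cofinal_meets_idealOfCofinals (⟨l, hE, hl⟩ : P) D (Sum.inr a)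
    exact ⟨b, s, hs, hb⟩
  choose F sF hsF hF using hF
  choose G sG hsG hG using hG
  have huniq : ∀ s ∈ I, ∀ t ∈ I, ∀ u ∈ s.graph, ∀ v ∈ t.graph, u.1 = v.1 ↔ u.2 = v.2 := by
    intro s hs t ht u hu v hv
    rw [le_antisymm_iff, le_antisymm_iff, hdir s hs t ht u hu v hv, hdir t ht s hs v hv u hu]
  refine ⟨⟨⟨F, G, fun a => ?_, fun a => ?_⟩, fun {a b} => ?_⟩, fun u hu => ?_⟩
  · exact (huniq _ (hsG (F a)) _ (hsF a) _ (hG (F a)) _ (hF a)).2 rfl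
  · exact (huniq _ (hsF (G a)) _ (hsG a) _ (hF (G a)) _ (hG a)).1 rfl
  · exact (hdir _ (hsF a) _ (hsF b) _ (hF a) _ (hF b)).symm
  · exact (huniq _ (hsF u.1) _ (Order.mem_idealOfCofinals _ _) _ (hF u.1) u hu).1 rfl

end SuccPred

/-! ### Homogeneity as a one-point extension property -/

section Homogeneity

variable {α : Type*} [LinearOrder α]

attribute [local instance] spStructure

/-- A substructure of `(α, ≤, s, p)` carries the restrictions of the ambient functions. -/
noncomputable abbrev substructureSpStructure (S : spLang.Substructure α) : spLang.Structure S :=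
  Language.Substructure.inducedStructure

attribute [local instance] substructureSpStructure

/-- An order automorphism as an automorphism of `(α, ≤, s, p)`. -/
def OrderIso.toSpEquiv (g : α ≃o α) : α ≃[spLang] α where
  toEquiv := g.toEquiv
  map_fun' := by
    rintro n (_ | _) x
    exacts [g.map_spSucc (x 0), g.map_spPred (x 0)]
  map_rel' := by
    rintro n (_ | _) x
    exact g.le_iff_le

theorem spAct_mem (S : spLang.Substructure α) {x : α} (hx : x ∈ S) (w : List Bool) :
    spAct x w ∈ S := by
  induction w generalizing x with
  | nil => exact hx
  | cons b w ih =>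
    refine ih ?_
    cases b
    · exact S.fun_mem SpFunc.p ![x] (by simpa using hx)
    · exact S.fun_mem SpFunc.s ![x] (by simpa using hx)

theorem exists_spAct_of_mem_closure {s : Set α} {x : α}
    (hx : x ∈ Language.Substructure.closure spLang s) : ∃ a ∈ s, ∃ w, x = spAct a w := by
  refine Language.Substructure.closure_induction (p := fun x => ∃ a ∈ s, ∃ w, x = spAct a w) hx
    (fun x hx => ⟨x, hx, [], rfl⟩) ?_
  rintro n (_ | _) x hx
  · obtain ⟨a, ha, w, hw⟩ := hx 0
    exact ⟨a, ha, w ++ [true], by rw [spAct_append, ← hw]; rfl⟩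
  · obtain ⟨a, ha, w, hw⟩ := hx 0
    exact ⟨a, ha, w ++ [false], by rw [spAct_append, ← hw]; rfl⟩

theorem spEmbedding_spAct {S : spLang.Substructure α} (f : S ↪[spLang] α) {x : α} (hx : x ∈ S)
    (w : List Bool) : f ⟨spAct x w, spAct_mem S hx w⟩ = spAct (f ⟨x, hx⟩) w := by
  induction w generalizing x with
  | nil => rfl
  | cons b w ih =>
    have hb : spStep b x ∈ S := spAct_mem S hx [b]
    refine (ih hb).trans ?_
    rw [spAct_cons]
    congr 1
    cases b
    · exact f.map_fun SpFunc.p ![⟨x, hx⟩]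
    · exact f.map_fun SpFunc.s ![⟨x, hx⟩]

theorem spEmbedding_le_iff {S : spLang.Substructure α} (f : S ↪[spLang] α) {x y : α} (hx : x ∈ S)
    (hy : y ∈ S) : f ⟨x, hx⟩ ≤ f ⟨y, hy⟩ ↔ x ≤ y :=
  f.map_rel Language.orderRel.le ![⟨x, hx⟩, ⟨y, hy⟩]

/-- Each point of the generated substructure is the value of some word at some generator;
`SpIso.eq_iff` makes the image independent of the chosen representation. -/
theorem SpIso.exists_embedding {l : List (α × α)} (hl : SpIso l) :
    ∃ f : Language.Substructure.closure spLang {x | ∃ u ∈ l, u.1 = x} ↪[spLang] α,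
      ∀ u ∈ l, ∃ h, f ⟨u.1, h⟩ = u.2 := by
  let S := Language.Substructure.closure spLang {x | ∃ u ∈ l, u.1 = x}
  have hS : ∀ x : S, ∃ u ∈ l, ∃ w, x.1 = spAct u.1 w := by
    rintro ⟨x, hx⟩
    obtain ⟨_, ⟨u, hu, rfl⟩, w, hw⟩ := exists_spAct_of_mem_closure hx
    exact ⟨u, hu, w, hw⟩
  choose U hU W hW using hS
  let f : S → α := fun x => spAct (U x).2 (W x)
  have hf : ∀ u ∈ l, ∀ w, ∀ x : S, x.1 = spAct u.1 w → f x = spAct u.2 w := by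
    intro u hu w x hx
    exact (hl.eq_iff (hU x) hu _ _).1 ((hW x).symm.trans hx)
  have hle : ∀ x y : S, f x ≤ f y ↔ x.1 ≤ y.1 := by
    intro x y
    rw [hW x, hW y]
    exact (hl _ (hU x) _ (hU y) _ _).symm
  refine ⟨⟨⟨f, fun x y h => ?_⟩, ?_, ?_⟩, fun u hu => ?_⟩
  · exact Subtype.ext (le_antisymm ((hle _ _).1 h.le) ((hle _ _).1 h.ge))
  · rintro n (_ | _) x
    · refine (hf (U (x 0)) (hU _) (W (x 0) ++ [true]) _ ?_).trans ?_
      · rw [spAct_append, ← hW]; rfl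
      · rw [spAct_append]; rfl
    · refine (hf (U (x 0)) (hU _) (W (x 0) ++ [false]) _ ?_).trans ?_
      · rw [spAct_append, ← hW]; rfl
      · rw [spAct_append]; rfl
  · rintro n (_ | _) x
    exact hle _ _
  · exact ⟨Language.Substructure.subset_closure ⟨u, hu, rfl⟩, hf u hu [] _ rfl⟩

theorem forall_embedding_extends_iff_spExt [Countable α] (E : Finset α) :
    (∀ S : spLang.Substructure α, S.FG → ∀ f : S ↪[spLang] α,
      (∀ a ∈ E, ∃ h : a ∈ S, f ⟨a, h⟩ = a) →
        ∃ g : α ≃[spLang] α, f = g.toEmbedding.comp S.subtype) ↔ SpExt (E : Set α) := by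
  constructor
  · intro H l hE hl c
    obtain ⟨f, hf⟩ := hl.exists_embedding
    have hfin : {x | ∃ u ∈ l, u.1 = x}.Finite :=
      (l.map Prod.fst).finite_toSet.subset fun x ⟨u, hu, e⟩ => List.mem_map.2 ⟨u, hu, e⟩
    obtain ⟨g, hg⟩ := H _ (Language.Substructure.fg_def.2 ⟨_, hfin, rfl⟩) f
      fun a ha => hf (a, a) (hE a ha)
    have hgle : ∀ x y, g x ≤ g y ↔ x ≤ y := fun x y => g.map_rel Language.orderRel.le ![x, y]
    let e : α ≃o α := ⟨g.toEquiv, fun {x y} => hgle x y⟩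
    have he : ∀ u ∈ (c, g c) :: l, u.2 = e u.1 := by
      intro u hu
      rcases List.mem_cons.1 hu with rfl | hu
      · rfl
      · obtain ⟨h, h'⟩ := hf u hu
        rw [← h', hg]
        rfl
    refine ⟨g c, fun u hu v hv w w' => ?_⟩
    rw [he u hu, he v hv, ← e.map_spAct, ← e.map_spAct, e.le_iff_le]
  · intro H S hS f hf
    obtain ⟨t, ht⟩ := hS
    classical
    have htS : ∀ x ∈ t ∪ E, x ∈ S := by
      intro x hx
      rcases Finset.mem_union.1 hx with hx | hx
      · rw [← ht]
        exact Language.Substructure.subset_closure hx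
      · exact (hf x hx).1
    -- `t` generates `S`, and `E` is added so that the list contains the pairs required by `SpExt`.
    let l : List (α × α) := (t ∪ E).attach.toList.map fun x => (x.1, f ⟨x.1, htS _ x.2⟩)
    have hl : ∀ x, ∀ hx : x ∈ t ∪ E, (x, f ⟨x, htS _ hx⟩) ∈ l := fun x hx =>
      List.mem_map.2 ⟨⟨x, hx⟩, by simp, rfl⟩
    have hl' : ∀ u ∈ l, ∃ hu : u.1 ∈ S, u.2 = f ⟨u.1, hu⟩ := by
      intro u hu
      obtain ⟨x, -, rfl⟩ := List.mem_map.1 hu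
      exact ⟨htS _ x.2, rfl⟩
    have hEl : ∀ e ∈ (E : Set α), (e, e) ∈ l := by
      intro e he
      obtain ⟨h1, h2⟩ := hf e he
      have := hl e (Finset.mem_union_right _ he)
      rwa [h2] at this
    have hiso : SpIso l := by
      intro u hu v hv w w'
      obtain ⟨hu, hu'⟩ := hl' u hu
      obtain ⟨hv, hv'⟩ := hl' v hv
      rw [hu', hv', ← spEmbedding_spAct f hu, ← spEmbedding_spAct f hv, spEmbedding_le_iff]
    obtain ⟨g, hg⟩ := H.exists_orderIso hEl hiso
    refine ⟨g.toSpEquiv, Language.Embedding.ext fun ⟨x, hx⟩ => ?_⟩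
    obtain ⟨a, ha, w, hw⟩ := exists_spAct_of_mem_closure (s := (t : Set α)) (by rw [ht]; exact hx)
    subst hw
    have ha' : a ∈ t ∪ E := Finset.mem_union_left _ ha
    refine (spEmbedding_spAct f (htS a ha') w).trans ?_
    have hga : f ⟨a, htS a ha'⟩ = g a := (hg _ (hl a ha')).symm
    rw [hga, ← g.map_spAct]
    rfl

theorem isSpHomogeneous_iff_spExt [Countable α] : IsSpHomogeneous α ↔ SpExt (∅ : Set α) := by
  rw [← Finset.coe_empty, ← forall_embedding_extends_iff_spExt]
  simp [IsSpHomogeneous, Language.IsUltrahomogeneous]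

theorem isWeaklySpHomogeneous_iff_spExt [Countable α] :
    IsWeaklySpHomogeneous α ↔ ∃ E : Finset α, SpExt (E : Set α) :=
  exists_congr forall_embedding_extends_iff_spExt

end Homogeneity

/-! ### Computability of compound expressions -/

section ComputableLemmas

variable {α β γ : Type} [Primcodable α] [Primcodable β] [Primcodable γ]

attribute [fun_prop] Computable
attribute [fun_prop] Computable.id Computable.const Computable.comp Computable.pair

@[fun_prop] theorem Computable.fst_comp {f : α → β × γ} (h : Computable f) :
    Computable fun a => (f a).1 := Computable.fst.comp h

@[fun_prop] theorem Computable.snd_comp {f : α → β × γ} (h : Computable f) :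
    Computable fun a => (f a).2 := Computable.snd.comp h

@[fun_prop] theorem Computable.getD_comp {f : α → List β} {g : α → ℕ} (hf : Computable f)
    (hg : Computable g) (d : β) : Computable fun a => (f a).getD (g a) d :=
  (Primrec.list_getD d).to_comp.comp hf hg

@[fun_prop] theorem Computable.length_comp {f : α → List β} (hf : Computable f) :
    Computable fun a => (f a).length := Primrec.list_length.to_comp.comp hf

@[fun_prop] theorem Computable.cons_comp {f : α → β} {g : α → List β} (hf : Computable f)
    (hg : Computable g) : Computable fun a => f a :: g a :=
  Primrec.list_cons.to_comp.comp hf hg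

@[fun_prop] theorem Computable.add_comp {f g : α → ℕ} (hf : Computable f) (hg : Computable g) :
    Computable fun a => f a + g a := Primrec.nat_add.to_comp.comp hf hg

@[fun_prop] theorem Computable.natPair_comp {f g : α → ℕ} (hf : Computable f)
    (hg : Computable g) : Computable fun a => Nat.pair (f a) (g a) :=
  Primrec₂.natPair.to_comp.comp hf hg

theorem ComputablePred.eq {f g : α → β} (hf : Computable f) (hg : Computable g) :
    ComputablePred fun a => f a = g a := by
  classical
  exact (Primrec.eq (α := β)).computablePred.comp (hf.pair hg)

theorem ComputablePred.lt {f g : α → ℕ} (hf : Computable f) (hg : Computable g) :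
    ComputablePred fun a => f a < g a :=
  ComputablePred.comp (p := fun x : ℕ × ℕ => x.1 < x.2) Primrec.nat_lt.computablePred (hf.pair hg)

theorem ComputablePred.le {f g : α → ℕ} (hf : Computable f) (hg : Computable g) :
    ComputablePred fun a => f a ≤ g a :=
  ComputablePred.comp (p := fun x : ℕ × ℕ => x.1 ≤ x.2) Primrec.nat_le.computablePred (hf.pair hg)

end ComputableLemmas

/-! ### Arithmetical definitions of homogeneity -/

section UpperBound

/-- The computation `φ_e(⟨x, y⟩)` halts with output `b`. -/
def PhiHalts (b e x y : ℕ) : Prop :=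
  ∃ k, Nat.Partrec.Code.evaln k (Denumerable.ofNat Nat.Partrec.Code e) (Nat.pair x y) = some b

theorem phiHalts_iff {b e x y : ℕ} : PhiHalts b e x y ↔ b ∈ phi e (Nat.pair x y) :=
  Nat.Partrec.Code.evaln_complete.symm

/-- `x ⋖ y` in `L_e`. -/
def PhiCov (e x y : ℕ) : Prop :=
  ¬ PhiHalts 1 e y x ∧ ∀ z, ¬ PhiHalts 0 e z x ∨ ¬ PhiHalts 0 e y z

/-- The function symbol `b` maps `x` to `y` in `L_e`. -/
def PhiStep (e : ℕ) (b : Bool) (x y : ℕ) : Prop :=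
  (b = true ∧ (PhiCov e x y ∨ x = y ∧ ∀ z, ¬ PhiCov e x z)) ∨
    (b = false ∧ (PhiCov e y x ∨ x = y ∧ ∀ z, ¬ PhiCov e z x))

/-- The word `w` maps `x` to `y` in `L_e`. -/
def PhiAct (e : ℕ) (w : List Bool) (x y : ℕ) : Prop :=
  ∃ l : List ℕ, l.getD 0 0 = x ∧ l.getD w.length 0 = y ∧
    ∀ i, i < w.length → PhiStep e (w.getD i true) (l.getD i 0) (l.getD (i + 1) 0)

/-- Comparison in `L_e` of the values of words at `x` and at `y`, with outcome `b`. -/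
def PhiCompare (b e x : ℕ) (w : List Bool) (y : ℕ) (w' : List Bool) : Prop :=
  ∃ a a' : ℕ, PhiAct e w x a ∧ PhiAct e w' y a' ∧ PhiHalts b e a a'

/-- Arithmetical form of `SpIso` for `L_e`. -/
def PhiIso (e : ℕ) (l : List (ℕ × ℕ)) : Prop :=
  ∀ (i j : ℕ) (w w' : List Bool), i < l.length → j < l.length →
    (¬ PhiCompare 1 e (l.getD i (0, 0)).1 w (l.getD j (0, 0)).1 w' ∨
      ¬ PhiCompare 0 e (l.getD i (0, 0)).2 w (l.getD j (0, 0)).2 w') ∧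
    (¬ PhiCompare 1 e (l.getD i (0, 0)).2 w (l.getD j (0, 0)).2 w' ∨
      ¬ PhiCompare 0 e (l.getD i (0, 0)).1 w (l.getD j (0, 0)).1 w')

/-- Arithmetical form of `SpExt` for `L_e`. -/
def PhiExt (e : ℕ) (E : List ℕ) : Prop :=
  ∀ (l : List (ℕ × ℕ)) (c : ℕ),
    (∀ i, i < E.length → ∃ j, j < l.length ∧ l.getD j (0, 0) = (E.getD i 0, E.getD i 0)) →
      PhiIso e l → ∃ d, PhiIso e ((c, d) :: l)

/-- Arithmetical form of the statement that `L_e` is defined. -/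
def PhiLinear (e : ℕ) : Prop :=
  ∀ x y z, (PhiHalts 0 e x y ∨ PhiHalts 1 e x y) ∧ PhiHalts 1 e x x ∧
    (PhiHalts 1 e x y ∨ PhiHalts 1 e y x) ∧
    (PhiHalts 1 e x y ∧ PhiHalts 1 e y x → x = y) ∧
    (PhiHalts 1 e x y ∧ PhiHalts 1 e y z → PhiHalts 1 e x z)

variable {α : Type} [Primcodable α]

theorem sigmaPred_phiHalts (b : ℕ) {e x y : α → ℕ} (he : Computable e) (hx : Computable x)
    (hy : Computable y) : SigmaPred 1 fun a => PhiHalts b (e a) (x a) (y a) := by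
  refine SigmaPred.ex (ComputablePred.sigma (ComputablePred.eq ?_ (by fun_prop)))
  have h1 : Computable fun p : α × ℕ =>
      ((p.2, Denumerable.ofNat Nat.Partrec.Code (e p.1)), Nat.pair (x p.1) (y p.1)) :=
    (Computable.snd.pair ((Computable.ofNat _).comp (he.comp Computable.fst))).pair (by fun_prop)
  exact Nat.Partrec.Code.primrec_evaln.to_comp.comp h1

/-- Order relations are expressed by the failure to halt with the opposite answer. For a
characteristic function this is equivalent to halting with the right answer, and it keeps the
definition Π⁰₁. -/
theorem piPred_phiCov {e x y : α → ℕ} (he : Computable e) (hx : Computable x)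
    (hy : Computable y) : PiPred 1 fun a => PhiCov (e a) (x a) (y a) :=
  (PiPred.not (sigmaPred_phiHalts 1 he hy hx)).and <| PiPred.all <|
    (PiPred.not (sigmaPred_phiHalts 0 (by fun_prop) (by fun_prop) (by fun_prop))).or
      (PiPred.not (sigmaPred_phiHalts 0 (by fun_prop) (by fun_prop) (by fun_prop)))

theorem piPred_phiStep {e x y : α → ℕ} {b : α → Bool} (he : Computable e) (hb : Computable b)
    (hx : Computable x) (hy : Computable y) :
    PiPred 2 fun a => PhiStep (e a) (b a) (x a) (y a) := by
  refine PiPred.or (PiPred.and (ComputablePred.eq hb (Computable.const _)).pi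
      (PiPred.or ((piPred_phiCov he hx hy).mono one_le_two)
        (PiPred.and (ComputablePred.eq hx hy).pi (PiPred.all (PiPred.not ?_)))))
    (PiPred.and (ComputablePred.eq hb (Computable.const _)).pi
      (PiPred.or ((piPred_phiCov he hy hx).mono one_le_two)
        (PiPred.and (ComputablePred.eq hx hy).pi (PiPred.all (PiPred.not ?_)))))
  all_goals
    exact (piPred_phiCov (by fun_prop) (by fun_prop) (by fun_prop)).toSigma one_lt_two

/-- A single existential quantifier over the list of intermediate values precedes a Π⁰₂ condition on
consecutive entries. -/
theorem sigmaPred_phiAct {e x y : α → ℕ} {w : α → List Bool} (he : Computable e)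
    (hw : Computable w) (hx : Computable x) (hy : Computable y) :
    SigmaPred 3 fun a => PhiAct (e a) (w a) (x a) (y a) := by
  refine SigmaPred.ex (PiPred.toSigma (n := 2) (PiPred.and
    (ComputablePred.eq (by fun_prop) (by fun_prop)).pi (PiPred.and
    (ComputablePred.eq (by fun_prop) (by fun_prop)).pi (PiPred.all (PiPred.imp
    (ComputablePred.lt (by fun_prop) (by fun_prop)).sigma ?_)))) (by norm_num))
  exact piPred_phiStep (by fun_prop) (by fun_prop) (by fun_prop) (by fun_prop)

theorem sigmaPred_phiCompare (b : ℕ) {e x y : α → ℕ} {w w' : α → List Bool} (he : Computable e)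
    (hx : Computable x) (hw : Computable w) (hy : Computable y) (hw' : Computable w') :
    SigmaPred 3 fun a => PhiCompare b (e a) (x a) (w a) (y a) (w' a) :=
  SigmaPred.ex <| SigmaPred.ex <|
    (sigmaPred_phiAct (by fun_prop) (by fun_prop) (by fun_prop) (by fun_prop)).and <|
    (sigmaPred_phiAct (by fun_prop) (by fun_prop) (by fun_prop) (by fun_prop)).and <|
    (sigmaPred_phiHalts b (by fun_prop) (by fun_prop) (by fun_prop)).mono (by norm_num)

/-- Both outcomes of a comparison are Σ⁰₃. Each direction of the equivalence excludes a pair of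
outcomes, so only negations of Σ⁰₃ statements occur. -/
theorem piPred_phiIso {e : α → ℕ} {l : α → List (ℕ × ℕ)} (he : Computable e)
    (hl : Computable l) : PiPred 3 fun a => PhiIso (e a) (l a) := by
  refine PiPred.all <| PiPred.all <| PiPred.all <| PiPred.all <|
    PiPred.imp (ComputablePred.lt (by fun_prop) (by fun_prop)).sigma <|
    PiPred.imp (ComputablePred.lt (by fun_prop) (by fun_prop)).sigma <|
    PiPred.and (PiPred.or (PiPred.not ?_) (PiPred.not ?_))
      (PiPred.or (PiPred.not ?_) (PiPred.not ?_))
  all_goals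
    exact sigmaPred_phiCompare _ (by fun_prop) (by fun_prop) (by fun_prop) (by fun_prop)
      (by fun_prop)

/-- The fixing condition and the isomorphism condition are hypotheses of level at most Π⁰₃ and the
conclusion is ∃ Π⁰₃, so the matrix is Σ⁰₄; the quantifiers over `l` and `c` raise it to Π⁰₅. -/
theorem piPred_phiExt {e : α → ℕ} {E : α → List ℕ} (he : Computable e)
    (hE : Computable E) : PiPred 5 fun a => PhiExt (e a) (E a) := by
  refine PiPred.all <| PiPred.all <| SigmaPred.toPi (n := 4) (SigmaPred.imp ?_ <|
    SigmaPred.imp ((piPred_phiIso (by fun_prop) (by fun_prop)).mono (by norm_num)) <|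
    SigmaPred.ex <| (piPred_phiIso (by fun_prop) (by fun_prop)).toSigma (by norm_num))
    (by norm_num)
  exact PiPred.mono (n := 2) (PiPred.all <| PiPred.imp
    (ComputablePred.lt (by fun_prop) (by fun_prop)).sigma <| SigmaPred.toPi (n := 1)
    (SigmaPred.ex <| SigmaPred.and (ComputablePred.lt (by fun_prop) (by fun_prop)).sigma
      (ComputablePred.eq (by fun_prop) (by fun_prop)).sigma) (by norm_num)) (by norm_num)

theorem piPred_phiLinear {e : α → ℕ} (he : Computable e) :
    PiPred 2 fun a => PhiLinear (e a) := by
  refine PiPred.all <| PiPred.all <| PiPred.all <| PiPred.and (PiPred.or ?_ ?_) <|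
    PiPred.and ?_ <| PiPred.and (PiPred.or ?_ ?_) <| PiPred.and
    (PiPred.imp (SigmaPred.and ?_ ?_) (ComputablePred.eq (by fun_prop) (by fun_prop)).pi)
    (PiPred.imp (SigmaPred.and ?_ ?_) ?_)
  all_goals
    first
    | exact (sigmaPred_phiHalts _ (by fun_prop) (by fun_prop) (by fun_prop)).toPi one_lt_two
    | exact (sigmaPred_phiHalts _ (by fun_prop) (by fun_prop) (by fun_prop)).mono one_le_two

/-! ### Correctness of the arithmetical definitions -/

theorem DefinesLinearOrder.phiHalts_one {e : ℕ} {o : LinearOrder ℕ} (h : DefinesLinearOrder e o)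
    (x y : ℕ) : PhiHalts 1 e x y ↔ o.le x y := by
  rw [phiHalts_iff, h x y]
  split_ifs with hxy <;> simp [hxy]

theorem DefinesLinearOrder.phiHalts_zero {e : ℕ} {o : LinearOrder ℕ} (h : DefinesLinearOrder e o)
    (x y : ℕ) : PhiHalts 0 e x y ↔ ¬ o.le x y := by
  rw [phiHalts_iff, h x y]
  split_ifs with hxy <;> simp [hxy]

/-- A linear order from its ordering relation. -/
noncomputable abbrev linearOrderOfLE {β : Type*} (r : β → β → Prop) (hrefl : ∀ x, r x x)
    (htrans : ∀ x y z, r x y → r y z → r x z) (hanti : ∀ x y, r x y → r y x → x = y)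
    (htotal : ∀ x y, r x y ∨ r y x) : LinearOrder β where
  le := r
  le_refl := hrefl
  le_trans := htrans
  le_antisymm := hanti
  le_total := htotal
  toDecidableLE := Classical.decRel r

theorem phiLinear_iff {e : ℕ} : PhiLinear e ↔ ∃ o : LinearOrder ℕ, DefinesLinearOrder e o := by
  classical
  constructor
  · intro h
    let o : LinearOrder ℕ := linearOrderOfLE (PhiHalts 1 e) (fun x => (h x x x).2.1)
      (fun x y z h1 h2 => (h x y z).2.2.2.2 ⟨h1, h2⟩)
      (fun x y h1 h2 => (h x y x).2.2.2.1 ⟨h1, h2⟩) (fun x y => (h x y x).2.2.1)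
    refine ⟨o, fun x y => ?_⟩
    have hle : o.le x y ↔ 1 ∈ phi e (Nat.pair x y) := phiHalts_iff
    split_ifs with hxy
    · exact Part.eq_some_iff.2 (hle.1 hxy)
    · refine Part.eq_some_iff.2 (((h x y x).1.resolve_right fun h' => hxy ?_ ) |> phiHalts_iff.1)
      exact h'
  · rintro ⟨o, h⟩ x y z
    simp only [h.phiHalts_one, h.phiHalts_zero]
    refine ⟨(em _).symm, o.le_refl _, o.le_total _ _, fun h => o.le_antisymm _ _ h.1 h.2,
      fun h => o.le_trans _ _ _ h.1 h.2⟩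

theorem covBy_iff_forall_le {β : Type*} [LinearOrder β] {x y : β} :
    x ⋖ y ↔ ¬ y ≤ x ∧ ∀ z, z ≤ x ∨ y ≤ z := by
  constructor
  · rintro ⟨h1, h2⟩
    refine ⟨not_le_of_gt h1, fun z => ?_⟩
    by_contra! hz
    exact h2 hz.1 hz.2
  · rintro ⟨h1, h2⟩
    refine ⟨lt_of_not_ge h1, fun z hz hz' => ?_⟩
    rcases h2 z with h2 | h2
    exacts [absurd hz (not_lt_of_ge h2), absurd hz' (not_lt_of_ge h2)]

theorem DefinesLinearOrder.phiCov_iff {e : ℕ} {o : LinearOrder ℕ} (h : DefinesLinearOrder e o)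
    (x y : ℕ) : PhiCov e x y ↔ @CovBy ℕ o.toLT x y := by
  simp only [PhiCov, h.phiHalts_one, h.phiHalts_zero, not_not]
  exact covBy_iff_forall_le.symm

theorem DefinesLinearOrder.phiStep_iff {e : ℕ} {o : LinearOrder ℕ} (h : DefinesLinearOrder e o)
    (b : Bool) (x y : ℕ) : PhiStep e b x y ↔ @spStep ℕ o b x = y := by
  cases b
  · simp only [PhiStep, h.phiCov_iff]
    exact Iff.trans (by simp) spPred_eq_iff.symm
  · simp only [PhiStep, h.phiCov_iff]
    exact Iff.trans (by simp) spSucc_eq_iff.symm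

theorem DefinesLinearOrder.phiAct_iff {e : ℕ} {o : LinearOrder ℕ} (h : DefinesLinearOrder e o)
    (w : List Bool) (x y : ℕ) : PhiAct e w x y ↔ @spAct ℕ o x w = y := by
  simp only [PhiAct, h.phiStep_iff]
  induction w generalizing x with
  | nil =>
    constructor
    · rintro ⟨l, h1, h2, -⟩
      exact h1.symm.trans h2
    · rintro rfl
      exact ⟨[x], by simp⟩
  | cons b w ih =>
    rw [spAct_cons, ← ih]
    constructor
    · rintro ⟨l, rfl, rfl, h3⟩
      refine ⟨l.tail, ?_, ?_, fun i hi => ?_⟩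
      · exact (by cases l <;> simp : l.tail.getD 0 0 = l.getD 1 0).trans
          (h3 0 (by simp)).symm
      · cases l <;> simp
      · have := h3 (i + 1) (by simpa using hi)
        cases l <;> simpa using this
    · rintro ⟨l, h1, h2, h3⟩
      refine ⟨x :: l, rfl, by simpa using h2, fun i hi => ?_⟩
      rcases i with _ | i
      · simpa using h1.symm
      · simpa using h3 i (by simpa using hi)

theorem DefinesLinearOrder.phiCompare_one {e : ℕ} {o : LinearOrder ℕ}
    (h : DefinesLinearOrder e o) (x : ℕ) (w : List Bool) (y : ℕ) (w' : List Bool) :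
    PhiCompare 1 e x w y w' ↔ o.le (@spAct ℕ o x w) (@spAct ℕ o y w') := by
  simp [PhiCompare, h.phiAct_iff, h.phiHalts_one]

theorem DefinesLinearOrder.phiCompare_zero {e : ℕ} {o : LinearOrder ℕ}
    (h : DefinesLinearOrder e o) (x : ℕ) (w : List Bool) (y : ℕ) (w' : List Bool) :
    PhiCompare 0 e x w y w' ↔ ¬ o.le (@spAct ℕ o x w) (@spAct ℕ o y w') := by
  simp [PhiCompare, h.phiAct_iff, h.phiHalts_zero]

theorem List.forall_mem_iff_getD {β : Type*} {l : List β} {p : β → Prop} (d : β) :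
    (∀ x ∈ l, p x) ↔ ∀ i, i < l.length → p (l.getD i d) := by
  rw [List.forall_mem_iff_forall_getElem]
  refine forall₂_congr fun i hi => ?_
  rw [List.getD_eq_getElem _ _ hi]

theorem DefinesLinearOrder.phiIso_iff {e : ℕ} {o : LinearOrder ℕ} (h : DefinesLinearOrder e o)
    (l : List (ℕ × ℕ)) : PhiIso e l ↔ @SpIso ℕ o l := by
  simp only [PhiIso, SpIso, h.phiCompare_one, h.phiCompare_zero, not_not,
    List.forall_mem_iff_getD (l := l) (0, 0)]
  constructor
  · intro H i hi j hj w w'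
    have := H i j w w' hi hj
    exact ⟨this.1.resolve_left ∘ not_not_intro, this.2.resolve_left ∘ not_not_intro⟩
  · intro H i j w w' hi hj
    have := H i hi j hj w w'
    exact ⟨(em _).symm.imp_right this.1, (em _).symm.imp_right this.2⟩

theorem DefinesLinearOrder.phiExt_iff {e : ℕ} {o : LinearOrder ℕ} (h : DefinesLinearOrder e o)
    (E : List ℕ) : PhiExt e E ↔ @SpExt ℕ o {x | x ∈ E} := by
  simp only [PhiExt, SpExt, h.phiIso_iff, Set.mem_ofPred_eq, List.forall_mem_iff_getD (l := E) 0]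
  have : ∀ (l : List (ℕ × ℕ)) (u : ℕ × ℕ),
      (∃ j, j < l.length ∧ l.getD j (0, 0) = u) ↔ u ∈ l := by
    intro l u
    rw [List.mem_iff_getElem]
    refine exists_congr fun i => ⟨?_, ?_⟩
    · rintro ⟨hi, rfl⟩
      exact ⟨hi, (List.getD_eq_getElem _ _ hi).symm⟩
    · rintro ⟨hi, rfl⟩
      exact ⟨hi, List.getD_eq_getElem _ _ hi⟩
  simp only [this]
  exact ⟨fun H l h1 h2 c => H l c h1 h2, fun H l c h1 h2 => H l h1 h2 c⟩

theorem isPiZero_spHomogeneousIndices : IsPiZero 5 spHomogeneousIndices := by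
  rw [isPiZero_iff]
  refine (((piPred_phiLinear Computable.id).mono (by norm_num)).and
    (piPred_phiExt Computable.id (Computable.const []))).of_iff fun e => ?_
  simp only [spHomogeneousIndices, Set.mem_ofPred_eq, phiLinear_iff]
  constructor
  · rintro ⟨o, h, ho⟩
    refine ⟨⟨o, h⟩, (h.phiExt_iff _).2 ?_⟩
    simpa using (@isSpHomogeneous_iff_spExt ℕ o _).1 ho
  · rintro ⟨⟨o, h⟩, he⟩
    refine ⟨o, h, (@isSpHomogeneous_iff_spExt ℕ o _).2 ?_⟩
    simpa using (h.phiExt_iff _).1 he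

theorem isSigmaZero_weaklySpHomogeneousIndices : IsSigmaZero 6 weaklySpHomogeneousIndices := by
  rw [isSigmaZero_iff]
  refine (((piPred_phiLinear Computable.id).toSigma (by norm_num)).and
    (SigmaPred.ex (p := PhiExt) ((piPred_phiExt Computable.fst Computable.snd).toSigma
      (by norm_num)))).of_iff fun e => ?_
  simp only [weaklySpHomogeneousIndices, Set.mem_ofPred_eq, phiLinear_iff]
  constructor
  · rintro ⟨o, h, ho⟩
    obtain ⟨E, hE⟩ := (@isWeaklySpHomogeneous_iff_spExt ℕ o _).1 ho
    refine ⟨⟨o, h⟩, E.toList, (h.phiExt_iff _).2 ?_⟩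
    simpa using hE
  · rintro ⟨⟨o, h⟩, E, he⟩
    refine ⟨o, h, (@isWeaklySpHomogeneous_iff_spExt ℕ o _).2 ⟨E.toFinset, ?_⟩⟩
    simpa using (h.phiExt_iff _).1 he

end UpperBound

/-! ### Blocks with a least element -/

section Blocks

variable {α β : Type*} [LinearOrder α] [LinearOrder β]

/-- `x` has an immediate successor. -/
def HasSucc (x : α) : Prop := ∃ y, x ⋖ y

/-- `x` has no immediate predecessor. -/
def IsRoot (x : α) : Prop := ∀ y, ¬ y ⋖ x

/-- The blocks of `x` and `y` have the same number of elements above `x` and above `y`. -/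
def SameLength (x : α) (y : β) : Prop := ∀ k, HasSucc (spSucc^[k] x) ↔ HasSucc (spSucc^[k] y)

theorem HasSucc.covBy {x : α} (h : HasSucc x) : x ⋖ spSucc x := by
  obtain ⟨y, hy⟩ := h
  rwa [spSucc_eq_of_covBy hy]

theorem le_spSucc (x : α) : x ≤ spSucc x := by
  by_cases h : HasSucc x
  · exact h.covBy.le
  · exact (spSucc_eq_self h).ge

theorem spPred_le (x : α) : spPred x ≤ x := by
  rcases spPred_eq_iff.1 (rfl : spPred x = spPred x) with h | ⟨h, -⟩
  exacts [h.le, h.ge]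

theorem spSucc_le_of_lt {x y : α} (h : x < y) : spSucc x ≤ y := by
  by_cases hx : HasSucc x
  · exact le_of_not_gt fun h' => hx.covBy.2 h h'
  · rw [spSucc_eq_self hx]
    exact h.le

theorem le_spPred_of_lt {x y : α} (h : x < y) : x ≤ spPred y := by
  rcases spPred_eq_iff.1 (rfl : spPred y = spPred y) with h' | ⟨h', -⟩
  · exact le_of_not_gt fun h'' => h'.2 h'' h
  · rw [← h']
    exact h.le

theorem IsRoot.spSucc_lt {x a : α} (h : IsRoot x) (ha : a < x) : spSucc a < x := by
  refine lt_of_le_of_ne (spSucc_le_of_lt ha) fun e => ?_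
  by_cases hs : HasSucc a
  · exact h a (e ▸ hs.covBy)
  · rw [spSucc_eq_self hs] at e
    exact ha.ne e

theorem IsRoot.le_spPred {x a : α} (h : IsRoot x) (ha : x ≤ a) : x ≤ spPred a := by
  rcases ha.eq_or_lt with rfl | ha
  · exact (spPred_eq_self fun ⟨y, hy⟩ => h y hy).ge
  · exact le_spPred_of_lt ha

theorem le_spSucc_iterate (k : ℕ) (x : α) : x ≤ spSucc^[k] x :=
  Function.id_le_iterate_of_id_le le_spSucc k x

theorem exists_covBy_of_finite_Icc {x y : α} (hxy : x < y) (h : (Set.Icc x y).Finite) :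
    ∃ z, x ⋖ z ∧ z ≤ y := by
  have hfin : (Set.Ioc x y).Finite := h.subset Set.Ioc_subset_Icc_self
  obtain ⟨z, hz, hmin⟩ := hfin.exists_minimal ⟨y, hxy, le_rfl⟩
  refine ⟨z, ⟨hz.1, fun t ht ht' => ?_⟩, hz.2⟩
  exact absurd ht' (not_lt_of_ge (hmin ⟨ht, ht'.le.trans hz.2⟩ ht'.le))

theorem exists_iterate_of_finite_Icc {x y : α} (hxy : x ≤ y) (h : (Set.Icc x y).Finite) :
    ∃ k, spSucc^[k] x = y := by
  induction hn : (Set.Icc x y).ncard using Nat.strong_induction_on generalizing x with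
  | _ n ih =>
    rcases hxy.eq_or_lt with rfl | hxy'
    · exact ⟨0, rfl⟩
    · obtain ⟨z, hz, hzy⟩ := exists_covBy_of_finite_Icc hxy' h
      have hsub : Set.Icc z y ⊂ Set.Icc x y :=
        ⟨Set.Icc_subset_Icc_left hz.le, fun h' => (h' ⟨le_rfl, hxy⟩).1.not_gt hz.lt⟩
      obtain ⟨k, hk⟩ := ih _ (hn ▸ Set.ncard_lt_ncard hsub h) hzy (h.subset hsub.1) rfl
      exact ⟨k + 1, by rw [Function.iterate_succ_apply, spSucc_eq_of_covBy hz, hk]⟩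

theorem exists_iterate_of_le_iterate {x y : α} {k : ℕ} (hxy : x ≤ y) (h : y ≤ spSucc^[k] x) :
    ∃ j, spSucc^[j] x = y := by
  induction k with
  | zero => exact ⟨0, hxy.antisymm h⟩
  | succ k ih =>
    rcases le_or_gt y (spSucc^[k] x) with h' | h'
    · exact ih h'
    · refine ⟨k + 1, le_antisymm ?_ h⟩
      rw [Function.iterate_succ_apply']
      exact spSucc_le_of_lt h'

/-! ### Action of words in `s` and `p` on blocks -/

theorem spAct_replicate (x : α) (k : ℕ) : spAct x (List.replicate k true) = spSucc^[k] x := by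
  induction k generalizing x with
  | zero => rfl
  | succ k ih => rw [List.replicate_succ, spAct_cons, ih]; rfl

theorem IsRoot.spAct_lt {x a : α} (h : IsRoot x) (ha : a < x) (w : List Bool) :
    spAct a w < x := by
  induction w generalizing a with
  | nil => exact ha
  | cons b w ih =>
    refine ih ?_
    cases b
    exacts [(spPred_le a).trans_lt ha, h.spSucc_lt ha]

theorem IsRoot.le_spAct {x a : α} (h : IsRoot x) (ha : x ≤ a) (w : List Bool) :
    x ≤ spAct a w := by
  induction w generalizing a with
  | nil => exact ha
  | cons b w ih =>
    refine ih ?_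
    cases b
    exacts [h.le_spPred ha, ha.trans (le_spSucc a)]

/-- A point above all iterates cannot step down onto one of them: it would cover that iterate and
hence be the next one. -/
theorem iterate_lt_spAct {x b : α} (h : ∀ k, spSucc^[k] x < b) (w : List Bool) :
    ∀ k, spSucc^[k] x < spAct b w := by
  induction w generalizing b with
  | nil => exact h
  | cons c w ih =>
    refine ih fun k => ?_
    cases c
    · show spSucc^[k] x < spPred b
      refine lt_of_le_of_ne (le_spPred_of_lt (h k)) fun e => ?_
      rcases spPred_eq_iff.1 (rfl : spPred b = spPred b) with h' | ⟨h', -⟩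
      · have := h (k + 1)
        rw [Function.iterate_succ_apply', e, spSucc_eq_of_covBy h'] at this
        exact this.false
      · exact (h k).ne (e.trans h'.symm)
    · exact (h k).trans_le (le_spSucc b)

/-- The position in a block after applying a word in `s` and `p`, for a block whose `k`-th element
has an immediate successor if and only if `τ k`. -/
noncomputable def blockIndex (τ : ℕ → Prop) (k : ℕ) (w : List Bool) : ℕ :=
  open Classical in
  w.foldl (fun k b => bif b then if τ k then k + 1 else k else k - 1) k

/-- Within a block that has a least element, a word acts on positions by a rule depending on the
pattern `τ` alone, so blocks with the same pattern look alike. The hypothesis on `k` says that the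
iteration has not stalled at a last element before step `k`. -/
theorem spAct_iterate_eq {x : α} (hx : IsRoot x) {τ : ℕ → Prop}
    (hτ : ∀ k, HasSucc (spSucc^[k] x) ↔ τ k) (w : List Bool) {k : ℕ} (hk : ∀ j < k, τ j) :
    spAct (spSucc^[k] x) w = spSucc^[blockIndex τ k w] x ∧ ∀ j < blockIndex τ k w, τ j := by
  classical
  induction w generalizing k with
  | nil => exact ⟨rfl, hk⟩
  | cons b w ih =>
    cases b
    · have h1 : spStep false (spSucc^[k] x) = spSucc^[k - 1] x := by
        cases k with
        | zero => exact spPred_eq_self fun ⟨y, hy⟩ => hx y hy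
        | succ k =>
          rw [Function.iterate_succ_apply']
          exact spPred_eq_of_covBy ((hτ k).2 (hk k (Nat.lt_succ_self k))).covBy
      rw [spAct_cons, h1]
      exact ih fun j hj => hk j (by omega)
    · by_cases h : τ k
      · have h1 : spStep true (spSucc^[k] x) = spSucc^[k + 1] x := by
          rw [Function.iterate_succ_apply']
          rfl
        have h2 : blockIndex τ k (true :: w) = blockIndex τ (k + 1) w := by
          simp [blockIndex, h]
        rw [spAct_cons, h1, h2]
        refine ih fun j hj => ?_
        rcases Nat.lt_succ_iff_lt_or_eq.1 hj with hj | rfl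
        exacts [hk j hj, h]
      · have h1 : spStep true (spSucc^[k] x) = spSucc^[k] x :=
          spSucc_eq_self fun h' => h ((hτ k).1 h')
        have h2 : blockIndex τ k (true :: w) = blockIndex τ k w := by
          simp [blockIndex, h]
        rw [spAct_cons, h1, h2]
        exact ih hk

theorem iterate_le_iterate_iff {x : α} {k j : ℕ} (hk : ∀ i < k, HasSucc (spSucc^[i] x))
    (hj : ∀ i < j, HasSucc (spSucc^[i] x)) : spSucc^[k] x ≤ spSucc^[j] x ↔ k ≤ j := by
  have key : ∀ k j, k < j → (∀ i < j, HasSucc (spSucc^[i] x)) →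
      spSucc^[k] x < spSucc^[j] x := by
    intro k j hkj
    induction hkj with
    | refl =>
      intro h
      rw [Function.iterate_succ_apply']
      exact (h k (Nat.lt_succ_self k)).covBy.lt
    | @step m _ ih =>
      intro h
      refine (ih fun i hi => h i (Nat.lt_succ_of_lt hi)).trans_le ?_
      rw [Nat.succ_eq_add_one, Function.iterate_succ_apply']
      exact le_spSucc _
  constructor
  · intro h
    by_contra! h'
    exact absurd h (not_le_of_gt (key j k h' hk))
  · intro h
    rcases h.eq_or_lt with rfl | h
    exacts [le_rfl, (key k j h hj).le]

/-- Iterates of the successor stall at the end of a finite block. Blocks of the same length stall at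
the same step, so `k` can be replaced by one genuine position valid for both. -/
theorem exists_iterate_eq_minimal (x : α) (y : β) (h : SameLength x y) (k : ℕ) :
    ∃ j, (∀ i < j, HasSucc (spSucc^[i] x)) ∧ spSucc^[k] x = spSucc^[j] x ∧
      spSucc^[k] y = spSucc^[j] y := by
  induction k with
  | zero => exact ⟨0, by simp, rfl, rfl⟩
  | succ k ih =>
    obtain ⟨j, hj, e, e'⟩ := ih
    rw [Function.iterate_succ_apply', Function.iterate_succ_apply', e, e']
    by_cases hs : HasSucc (spSucc^[j] x)
    · refine ⟨j + 1, fun i hi => ?_, ?_, ?_⟩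
      · rcases Nat.lt_succ_iff_lt_or_eq.1 hi with hi | rfl
        exacts [hj i hi, hs]
      all_goals rw [Function.iterate_succ_apply']
    · exact ⟨j, hj, spSucc_eq_self hs, spSucc_eq_self fun h' => hs ((h j).2 h')⟩

theorem SameLength.spAct_le_iff {x y : α} (hx : IsRoot x) (hy : IsRoot y) (h : SameLength x y)
    (k : ℕ) (w w' : List Bool) :
    spAct (spSucc^[k] x) w ≤ spAct (spSucc^[k] x) w' ↔
      spAct (spSucc^[k] y) w ≤ spAct (spSucc^[k] y) w' := by
  obtain ⟨j, hj, e, e'⟩ := exists_iterate_eq_minimal x y h k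
  rw [e, e']
  have hx' := fun w => spAct_iterate_eq hx (fun _ => Iff.rfl) w hj
  have hy' := fun w => spAct_iterate_eq hy (fun k => (h k).symm) w hj
  rw [(hx' w).1, (hx' w').1, (hy' w).1, (hy' w').1, iterate_le_iterate_iff (hx' w).2 (hx' w').2,
    iterate_le_iterate_iff (fun i hi => (h i).1 ((hy' w).2 i hi))
      (fun i hi => (h i).1 ((hy' w').2 i hi))]

theorem exists_spAct_iterate_eq {x : α} (k : ℕ) : ∃ w, spAct (spSucc^[k] x) w = x := by
  induction k with
  | zero => exact ⟨[], rfl⟩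
  | succ k ih =>
    obtain ⟨w, hw⟩ := ih
    rw [Function.iterate_succ_apply']
    by_cases hs : HasSucc (spSucc^[k] x)
    · refine ⟨false :: w, ?_⟩
      rw [spAct_cons, show spStep false (spSucc (spSucc^[k] x)) = spSucc^[k] x from
        spPred_eq_of_covBy hs.covBy, hw]
    · exact ⟨w, by rw [spSucc_eq_self hs, hw]⟩

theorem SpIso.cons_spAct {l : List (α × α)} (h : SpIso l) {u : α × α} (hu : u ∈ l)
    (w : List Bool) : SpIso ((spAct u.1 w, spAct u.2 w) :: l) := by
  have key : ∀ v ∈ (spAct u.1 w, spAct u.2 w) :: l, ∃ v' ∈ l, ∃ t : List Bool,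
      v.1 = spAct v'.1 t ∧ v.2 = spAct v'.2 t := by
    intro v hv
    rcases List.mem_cons.1 hv with rfl | hv
    exacts [⟨u, hu, w, rfl, rfl⟩, ⟨v, hv, [], rfl, rfl⟩]
  intro v hv v' hv' t t'
  obtain ⟨a, ha, r, e1, e2⟩ := key v hv
  obtain ⟨a', ha', r', e1', e2'⟩ := key v' hv'
  rw [e1, e2, e1', e2', ← spAct_append, ← spAct_append, ← spAct_append, ← spAct_append]
  exact h a ha a' ha' _ _

/-- If all blocks have a least element, and each block length that occurs is realized
between any two finite sets compatible with `E`, then partial isomorphisms fixing `E` extend. -/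
theorem spExt_of_shuffle {E : Set α} (H0 : ∀ x : α, ∃ x₀, IsRoot x₀ ∧ ∃ k, spSucc^[k] x₀ = x)
    (H1 : ∀ x₀ : α, IsRoot x₀ → ∀ A B : Set α, A.Finite → B.Finite →
      (∀ a ∈ A, ∀ b ∈ B, a < b ∧ ∀ k, spSucc^[k] a ≠ b) →
      (∀ e ∈ E, (e ∈ A ∧ e < x₀) ∨ (e ∈ B ∧ x₀ < e)) →
      ∃ y₀, IsRoot y₀ ∧ SameLength x₀ y₀ ∧ (∀ a ∈ A, a < y₀) ∧
        ∀ b ∈ B, ∀ k, spSucc^[k] y₀ < b) : SpExt E := by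
  intro l hE hl c
  by_cases hc : ∃ u ∈ l, ∃ w, spAct u.1 w = c
  · obtain ⟨u, hu, w, rfl⟩ := hc
    exact ⟨_, hl.cons_spAct hu w⟩
  push Not at hc
  obtain ⟨x₀, hx₀, k, rfl⟩ := H0 c
  -- Every point of a block generates its root and thus all later points. As `c` is not generated by
  -- `l`, no first component in `l` lies in the block of `c`.
  have hout : ∀ u ∈ l, ∀ j, spSucc^[j] x₀ ≠ u.1 := by
    intro u hu j e
    obtain ⟨w, hw⟩ := exists_spAct_iterate_eq (x := x₀) j
    refine hc u hu (w ++ List.replicate k true) ?_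
    rw [spAct_append, ← e, hw, spAct_replicate]
  -- The block is convex, so each of these points lies to the left of the root or beyond all its
  -- iterates.
  have hsplit : ∀ u ∈ l, u.1 < x₀ ∨ ∀ j, spSucc^[j] x₀ < u.1 := by
    intro u hu
    refine or_iff_not_imp_left.2 fun h j => lt_of_not_ge fun h' => ?_
    obtain ⟨i, hi⟩ := exists_iterate_of_le_iterate (le_of_not_gt h) h'
    exact hout u hu i hi
  have hfin : ∀ p : α × α → Prop, {a | ∃ u ∈ l, p u ∧ u.2 = a}.Finite := fun p =>
    (l.map Prod.snd).finite_toSet.subset fun a ⟨u, hu, _, e⟩ => List.mem_map.2 ⟨u, hu, e⟩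
  -- `A` and `B` are the images of the points to the left and to the right of `x₀`; the new point
  -- takes position `k` in a block of the same length placed between them.
  obtain ⟨y₀, hy₀, hlen, hA, hB⟩ := H1 x₀ hx₀ _ _ (hfin fun u => u.1 < x₀)
    (hfin fun u => x₀ < u.1) (by
      rintro _ ⟨u, hu, hux, rfl⟩ _ ⟨v, hv, hvx, rfl⟩
      refine ⟨(hl.lt_iff hu hv).1 (hux.trans hvx), fun j e => ?_⟩
      have := (hl.eq_iff hu hv (List.replicate j true) []).2 (by
        rw [spAct_replicate]
        exact e)
      exact ((hx₀.spAct_lt hux _).trans hvx).ne this)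
    (by
      intro e he
      rcases hsplit _ (hE e he) with h | h
      exacts [Or.inl ⟨⟨_, hE e he, h, rfl⟩, h⟩, Or.inr ⟨⟨_, hE e he, h 0, rfl⟩, h 0⟩])
  have key : ∀ u ∈ l, ∀ w w',
      (spAct (spSucc^[k] x₀) w ≤ spAct u.1 w' ↔ spAct (spSucc^[k] y₀) w ≤ spAct u.2 w') ∧
      (spAct u.1 w' ≤ spAct (spSucc^[k] x₀) w ↔ spAct u.2 w' ≤ spAct (spSucc^[k] y₀) w) := by
    intro u hu w w'
    rcases hsplit u hu with h | h
    · have h1 : spAct u.1 w' < spAct (spSucc^[k] x₀) w :=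
        (hx₀.spAct_lt h w').trans_le (hx₀.le_spAct (le_spSucc_iterate k x₀) w)
      have h2 : spAct u.2 w' < spAct (spSucc^[k] y₀) w :=
        (hy₀.spAct_lt (hA _ ⟨u, hu, h, rfl⟩) w').trans_le
          (hy₀.le_spAct (le_spSucc_iterate k y₀) w)
      exact ⟨iff_of_false h1.not_ge h2.not_ge, iff_of_true h1.le h2.le⟩
    · obtain ⟨j, hj, e, e'⟩ := exists_iterate_eq_minimal x₀ y₀ hlen k
      have h1 : spAct (spSucc^[k] x₀) w < spAct u.1 w' := by
        rw [e, (spAct_iterate_eq hx₀ (fun _ => Iff.rfl) w hj).1]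
        exact iterate_lt_spAct h w' _
      have h2 : spAct (spSucc^[k] y₀) w < spAct u.2 w' := by
        rw [e', (spAct_iterate_eq hy₀ (fun k => (hlen k).symm) w hj).1]
        exact iterate_lt_spAct (hB _ ⟨u, hu, h 0, rfl⟩) w' _
      exact ⟨iff_of_true h1.le h2.le, iff_of_false h1.not_ge h2.not_ge⟩
  refine ⟨spSucc^[k] y₀, fun u hu v hv w w' => ?_⟩
  rcases List.mem_cons.1 hu with rfl | hu <;> rcases List.mem_cons.1 hv with rfl | hv
  · exact hlen.spAct_le_iff hx₀ hy₀ k w w'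
  · exact (key v hv w w').1
  · exact (key u hu w' w).2
  · exact hl u hu v hv w w'

/-! ### Blocks in convex suborders without end points -/

theorem exists_eq_of_apply_covBy [NoMaxOrder α] (f : α ↪o β) (hf : (Set.range f).OrdConnected)
    {x : α} {y : β} (h : f x ⋖ y) : ∃ z, f z = y ∧ x ⋖ z := by
  obtain ⟨t, ht⟩ := exists_gt x
  obtain ⟨z, rfl⟩ : y ∈ Set.range f := hf.out ⟨x, rfl⟩ ⟨t, rfl⟩
    ⟨h.le, le_of_not_gt fun h' => h.2 (f.lt_iff_lt.2 ht) h'⟩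
  exact ⟨z, rfl, (hf.apply_covBy_apply_iff f).1 h⟩

theorem exists_eq_of_covBy_apply [NoMinOrder α] (f : α ↪o β) (hf : (Set.range f).OrdConnected)
    {x : α} {y : β} (h : y ⋖ f x) : ∃ z, f z = y ∧ z ⋖ x := by
  obtain ⟨t, ht⟩ := exists_lt x
  obtain ⟨z, rfl⟩ : y ∈ Set.range f := hf.out ⟨t, rfl⟩ ⟨x, rfl⟩
    ⟨le_of_not_gt fun h' => h.2 h' (f.lt_iff_lt.2 ht), h.le⟩
  exact ⟨z, rfl, (hf.apply_covBy_apply_iff f).1 h⟩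

theorem hasSucc_apply_iff [NoMaxOrder α] (f : α ↪o β) (hf : (Set.range f).OrdConnected)
    {x : α} : HasSucc (f x) ↔ HasSucc x := by
  constructor
  · rintro ⟨y, hy⟩
    obtain ⟨z, -, hz⟩ := exists_eq_of_apply_covBy f hf hy
    exact ⟨z, hz⟩
  · rintro ⟨y, hy⟩
    exact ⟨f y, (hf.apply_covBy_apply_iff f).2 hy⟩

theorem isRoot_apply [NoMinOrder α] (f : α ↪o β) (hf : (Set.range f).OrdConnected)
    {x : α} (hx : IsRoot x) : IsRoot (f x) := by
  intro y hy
  obtain ⟨z, -, hz⟩ := exists_eq_of_covBy_apply f hf hy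
  exact hx z hz

theorem spSucc_iterate_apply [NoMaxOrder α] (f : α ↪o β) (hf : (Set.range f).OrdConnected)
    (k : ℕ) (x : α) : spSucc^[k] (f x) = f (spSucc^[k] x) := by
  induction k generalizing x with
  | zero => rfl
  | succ k ih =>
    rw [Function.iterate_succ_apply, Function.iterate_succ_apply, ← ih]
    congr 1
    by_cases h : HasSucc x
    · exact spSucc_eq_of_covBy ((hf.apply_covBy_apply_iff f).2 h.covBy)
    · rw [spSucc_eq_self h]
      exact spSucc_eq_self fun h' => h ((hasSucc_apply_iff f hf).1 h')

end Blocks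

/-! ### Orders of words over a coloured dense order -/

section Words

/-- Data for an order of words. The letters are pairs `(q, j)`; a word `(q, j) :: u` is admitted
when `u` is, and the number of `u` fits at the place `j` of a letter of colour `color q`. -/
structure WordData (Q : Type) [LinearOrder Q] where
  /-- The colour of an element of the dense order. -/
  color : Q → ℕ
  exists_between : ∀ k q q', q < q' → ∃ p, q < p ∧ p < q' ∧ color p = k
  exists_below : ∀ k q, ∃ p, p < q ∧ color p = k
  exists_above : ∀ k q, ∃ p, q < p ∧ color p = k
  /-- The number of a word. -/
  code : List (Q ×ₗ ℕ) → ℕ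
  code_injective : Function.Injective code
  code_nil : code [] = 0
  /-- `fits i c j n`: the word with number `n` may follow a letter at place `j` of colour `c`. -/
  fits : ℕ → ℕ → ℕ → ℕ → Prop
  fits_even : ∀ i k j n, fits i (2 * k) j n ↔ j ≤ k ∧ n = 0
  fits_odd_zero : ∀ i m j, fits i (2 * m + 1) j 0
  fits_odd_antitone : ∀ i m j n n', n' ≤ n → fits i (2 * m + 1) j n → fits i (2 * m + 1) j n'
  fits_odd_mono : ∀ i m j j' n, j ≤ j' → fits i (2 * m + 1) j n → fits i (2 * m + 1) j' n

variable {Q : Type} [LinearOrder Q] (D : WordData Q)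

namespace WordData

/-- Admitted words. The parameter `ι` gives the index used with the first letter, which is passed
on to all letters below it. -/
def Valid : (Q → ℕ) → List (Q ×ₗ ℕ) → Prop
  | _, [] => True
  | ι, a :: u => Valid (fun _ => ι (ofLex a).1) u ∧
      D.fits (ι (ofLex a).1) (D.color (ofLex a).1) (ofLex a).2 (D.code u)

/-- The order of nonempty admitted words. -/
abbrev Words (ι : Q → ℕ) : Type := {u : List (Q ×ₗ ℕ) // u ≠ [] ∧ D.Valid ι u}

/-- All words may follow at place `j`. -/
def Full (i c j : ℕ) : Prop := ∀ n, D.fits i c j n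

/-- Some colour produces blocks of type `ω` at index `i`. -/
def HasOmega (i : ℕ) : Prop := ∃ m, ∀ j, ¬ D.Full i (2 * m + 1) j

theorem cons_lt_cons_iff {q q' : Q} {j j' : ℕ} {u v : List (Q ×ₗ ℕ)} :
    (toLex (q, j) :: u : List (Q ×ₗ ℕ)) < toLex (q', j') :: v ↔
      q < q' ∨ q = q' ∧ (j < j' ∨ j = j' ∧ u < v) := by
  rw [List.cons_lt_cons_iff, Prod.Lex.toLex_lt_toLex, toLex.injective.eq_iff, Prod.mk.injEq]
  tauto

theorem cons_le_cons_iff {a : Q ×ₗ ℕ} {u v : List (Q ×ₗ ℕ)} : a :: u ≤ a :: v ↔ u ≤ v := by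
  rw [← not_lt, ← not_lt, List.cons_lt_cons_iff]
  simp

theorem eq_nil_of_le_nil {u : List (Q ×ₗ ℕ)} (h : u ≤ []) : u = [] := by
  cases u with
  | nil => rfl
  | cons a u => exact absurd (List.nil_lt_cons a u) (not_lt_of_ge h)

variable {D} {ι : Q → ℕ}

theorem fits_antitone {i c j n n' : ℕ} (hn : n' ≤ n) (h : D.fits i c j n) : D.fits i c j n' := by
  obtain ⟨k, rfl | rfl⟩ := Nat.even_or_odd' c
  · rw [D.fits_even] at h ⊢
    omega
  · exact D.fits_odd_antitone _ _ _ _ _ hn h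

theorem Full.exists_odd {i c j : ℕ} (h : D.Full i c j) : ∃ m, c = 2 * m + 1 := by
  obtain ⟨k, rfl | rfl⟩ := Nat.even_or_odd' c
  · exact absurd ((D.fits_even _ _ _ _).1 (h 1)).2 one_ne_zero
  · exact ⟨k, rfl⟩

theorem Full.mono {i c j j' : ℕ} (hj : j ≤ j') (h : D.Full i c j) : D.Full i c j' := by
  obtain ⟨m, rfl⟩ := h.exists_odd
  exact fun n => D.fits_odd_mono _ _ _ _ _ hj (h n)

theorem fits_zero {i c : ℕ} : D.fits i c 0 0 := by
  obtain ⟨k, rfl | rfl⟩ := Nat.even_or_odd' c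
  · exact (D.fits_even _ _ _ _).2 ⟨Nat.zero_le _, rfl⟩
  · exact D.fits_odd_zero _ _ _

theorem Full.fits_succ_zero {i c j j' : ℕ} (h : D.Full i c j) : D.fits i c j' 0 := by
  obtain ⟨m, rfl⟩ := h.exists_odd
  exact D.fits_odd_zero _ _ _

theorem finite_fits {i c j : ℕ} (h : ¬ D.Full i c j) :
    {u : List (Q ×ₗ ℕ) | D.fits i c j (D.code u)}.Finite := by
  obtain ⟨n, hn⟩ := not_forall.1 h
  refine ((Set.finite_lt_nat n).preimage D.code_injective.injOn).subset fun u hu => ?_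
  by_contra h'
  exact hn (fits_antitone (not_lt.1 h') hu)

theorem valid_nil : D.Valid ι [] := by
  simp [Valid]

/-- The word `(q, j) :: u`. -/
def consWord (q : Q) (j : ℕ) (u : List (Q ×ₗ ℕ)) (h : D.Valid (fun _ => ι q) u)
    (h' : D.fits (ι q) (D.color q) j (D.code u)) : D.Words ι :=
  ⟨toLex (q, j) :: u, List.cons_ne_nil _ _, h, h'⟩

/-- The one-letter word `(q, j)`. -/
def single (q : Q) (j : ℕ) (h : D.fits (ι q) (D.color q) j 0) : D.Words ι :=
  consWord q j [] valid_nil (by rwa [D.code_nil])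

/-- The one-letter word `(q, 0)`. -/
def base (D : WordData Q) (ι : Q → ℕ) (q : Q) : D.Words ι := single q 0 fits_zero

/-- The first component of the first letter. -/
def top (x : D.Words ι) : Q := (ofLex (x.1.head x.2.1)).1

@[simp] theorem top_consWord (q : Q) (j : ℕ) (u : List (Q ×ₗ ℕ)) (h : D.Valid (fun _ => ι q) u)
    (h' : D.fits (ι q) (D.color q) j (D.code u)) : top (consWord q j u h h') = q := rfl

@[simp] theorem top_base (q : Q) : top (base D ι q) = q := rfl

theorem exists_eq_consWord (x : D.Words ι) : ∃ q j u h h', x = consWord q j u h h' := by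
  obtain ⟨_ | ⟨a, u⟩, h, h'⟩ := x
  · exact absurd rfl h
  · exact ⟨(ofLex a).1, (ofLex a).2, u, h'.1, h'.2, rfl⟩

theorem consWord_lt_iff {q q' : Q} {j j' : ℕ} {u v : List (Q ×ₗ ℕ)}
    {h : D.Valid (fun _ => ι q) u} {h' : D.fits (ι q) (D.color q) j (D.code u)}
    {k : D.Valid (fun _ => ι q') v} {k' : D.fits (ι q') (D.color q') j' (D.code v)} :
    consWord q j u h h' < consWord q' j' v k k' ↔
      q < q' ∨ q = q' ∧ (j < j' ∨ j = j' ∧ u < v) :=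
  cons_lt_cons_iff

theorem lt_of_top_lt {x y : D.Words ι} (h : top x < top y) : x < y := by
  obtain ⟨q, j, u, h1, h2, rfl⟩ := exists_eq_consWord x
  obtain ⟨q', j', v, h3, h4, rfl⟩ := exists_eq_consWord y
  exact consWord_lt_iff.2 (Or.inl h)

theorem top_le_of_le {x y : D.Words ι} (h : x ≤ y) : top x ≤ top y :=
  le_of_not_gt fun h' => absurd (lt_of_top_lt h') (not_lt_of_ge h)

instance : NoMinOrder (D.Words ι) where
  exists_lt x := by
    obtain ⟨p, hp, -⟩ := D.exists_below 0 (top x)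
    exact ⟨base D ι p, lt_of_top_lt hp⟩

instance : NoMaxOrder (D.Words ι) where
  exists_gt x := by
    obtain ⟨p, hp, -⟩ := D.exists_above 0 (top x)
    exact ⟨base D ι p, lt_of_top_lt hp⟩

theorem top_eq_of_covBy {x y : D.Words ι} (h : x ⋖ y) : top x = top y := by
  refine (top_le_of_le h.le).eq_or_lt.resolve_right fun h' => ?_
  obtain ⟨p, hp, hp', -⟩ := D.exists_between 0 _ _ h'
  exact h.2 (c := base D ι p) (lt_of_top_lt hp) (lt_of_top_lt hp')

theorem top_iterate (k : ℕ) (x : D.Words ι) : top (spSucc^[k] x) = top x := by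
  induction k with
  | zero => rfl
  | succ k ih =>
    rw [Function.iterate_succ_apply', ← ih]
    by_cases h : HasSucc (spSucc^[k] x)
    · exact (top_eq_of_covBy h.covBy).symm
    · rw [spSucc_eq_self h]

theorem isRoot_base (q : Q) : IsRoot (base D ι q) := by
  intro y hy
  obtain ⟨q', j, u, h1, h2, rfl⟩ := exists_eq_consWord y
  obtain rfl : q' = q := top_eq_of_covBy hy
  have hlt := hy.lt
  rw [base, single, consWord_lt_iff] at hlt
  simp at hlt

theorem exists_forall_cons_lt {v : List (Q ×ₗ ℕ)} (hv : v ≠ []) :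
    ∃ r : Q, ∀ p < r, ∀ (j : ℕ) (w : List (Q ×ₗ ℕ)), toLex (p, j) :: w < v := by
  obtain ⟨a, v, rfl⟩ := List.exists_cons_of_ne_nil hv
  exact ⟨(ofLex a).1, fun p hp j w => cons_lt_cons_iff (j' := (ofLex a).2).2 (Or.inl hp)⟩

theorem exists_forall_lt_cons (q : Q) (u : List (Q ×ₗ ℕ)) :
    ∃ r : Q, ∀ p > r, ∀ (j : ℕ) (w : List (Q ×ₗ ℕ)), u < toLex (p, j) :: w := by
  cases u with
  | nil => exact ⟨q, fun p _ j w => List.nil_lt_cons _ _⟩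
  | cons a u =>
    exact ⟨(ofLex a).1, fun p hp j w => cons_lt_cons_iff (j := (ofLex a).2).2 (Or.inl hp)⟩

/-- The words following a letter at a place where all words fit. -/
def lift (q : Q) (j : ℕ) (h : D.Full (ι q) (D.color q) j) :
    D.Words (fun _ => ι q) ↪o D.Words ι :=
  OrderEmbedding.ofMapLEIff (fun u => consWord q j u.1 u.2.2 (h _)) fun _ _ => cons_le_cons_iff

theorem lift_apply (q : Q) (j : ℕ) (h : D.Full (ι q) (D.color q) j)
    (u : D.Words (fun _ => ι q)) : lift q j h u = consWord q j u.1 u.2.2 (h _) := rfl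

theorem lift_eq (q : Q) (j : ℕ) (h : D.Full (ι q) (D.color q) j) {u : List (Q ×ₗ ℕ)}
    (hu : u ≠ []) (h1 : D.Valid (fun _ => ι q) u)
    (h2 : D.fits (ι q) (D.color q) j (D.code u)) :
    consWord q j u h1 h2 = lift q j h ⟨u, hu, h1⟩ := rfl

/-- A word between two words starting with `(q, j)` starts with it too; its tail is nonempty because
the one-letter word is below all its proper extensions. -/
theorem ordConnected_range_lift (q : Q) (j : ℕ) (h : D.Full (ι q) (D.color q) j) :
    (Set.range (lift q j h)).OrdConnected := by
  refine ⟨?_⟩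
  rintro _ ⟨⟨u, hu, hu'⟩, rfl⟩ _ ⟨⟨v, hv, hv'⟩, rfl⟩ x ⟨hx, hx'⟩
  obtain ⟨q', j', w, h1, h2, rfl⟩ := exists_eq_consWord x
  obtain rfl : q' = q := le_antisymm (top_le_of_le hx') (top_le_of_le hx)
  rw [← not_lt, lift_apply, consWord_lt_iff] at hx hx'
  simp only [lt_irrefl, false_or, true_and, not_or, not_and, not_lt] at hx hx'
  obtain rfl : j = j' := le_antisymm hx.1 hx'.1
  have hw : w ≠ [] := by
    rintro rfl
    exact hu (eq_nil_of_le_nil (hx.2 rfl))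
  exact ⟨⟨w, hw, h1⟩, rfl⟩

/-- What follows the letter at a full place is a copy of an order without least element. -/
theorem not_hasSucc_single {q : Q} {j : ℕ} (h : D.Full (ι q) (D.color q) j) :
    ¬ HasSucc (single (D := D) (ι := ι) q j (h 0)) := by
  rintro ⟨y, hy⟩
  obtain ⟨q', j', v, h1, h2, rfl⟩ := exists_eq_consWord y
  obtain rfl : q = q' := top_eq_of_covBy hy
  have hlt := hy.lt
  rw [single, consWord_lt_iff] at hlt
  simp only [lt_irrefl, false_or, true_and] at hlt
  have key : ∃ p : Q, j < j' ∨ j = j' ∧ [toLex (p, 0)] < v := by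
    rcases hlt with hlt | ⟨hlt, hv⟩
    · exact ⟨q, Or.inl hlt⟩
    · obtain ⟨r, hr⟩ := exists_forall_cons_lt (v := v) (by
        rintro rfl
        exact lt_irrefl _ hv)
      obtain ⟨p, hp, -⟩ := D.exists_below 0 r
      exact ⟨p, Or.inr ⟨hlt, hr p hp _ _⟩⟩
  obtain ⟨p, hp⟩ := key
  refine hy.2 (c := lift q j h (base D _ p)) ?_ ?_
  · rw [lift_apply, single, consWord_lt_iff]
    exact Or.inr ⟨rfl, Or.inr ⟨rfl, List.nil_lt_cons _ _⟩⟩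
  · rw [lift_apply, consWord_lt_iff]
    exact Or.inr ⟨rfl, hp⟩

/-- The copy placed after `(q, j)` has no greatest element, and `(q, j + 1)` comes directly above
it. -/
theorem isRoot_single_succ {q : Q} {j : ℕ} (h : D.Full (ι q) (D.color q) j) :
    IsRoot (single (D := D) (ι := ι) q (j + 1) h.fits_succ_zero) := by
  intro y hy
  obtain ⟨q', j', v, h1, h2, rfl⟩ := exists_eq_consWord y
  obtain rfl : q' = q := top_eq_of_covBy hy
  have hlt := hy.lt
  rw [single, consWord_lt_iff] at hlt
  simp only [lt_irrefl, false_or, true_and, List.not_lt_nil, and_false, or_false] at hlt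
  obtain ⟨r, hr⟩ := exists_forall_lt_cons q' v
  obtain ⟨p, hp, -⟩ := D.exists_above 0 r
  refine hy.2 (c := lift q' j h (base D _ p)) ?_ ?_
  · rw [lift_apply, consWord_lt_iff]
    refine Or.inr ⟨rfl, ?_⟩
    exact (Nat.lt_succ_iff_lt_or_eq.1 hlt).imp_right fun h => ⟨h, hr p hp _ _⟩
  · rw [lift_apply, single, consWord_lt_iff]
    exact Or.inr ⟨rfl, Or.inl (Nat.lt_succ_self j)⟩

/-- Finitely many places are involved, and a place that is not full admits finitely many words. The
last place may be full if the upper bound is the letter alone, since then only the empty tail is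
allowed there. -/
theorem finite_Icc_consWord {q : Q} {j j' : ℕ} {u v : List (Q ×ₗ ℕ)}
    {h : D.Valid (fun _ => ι q) u} {h' : D.fits (ι q) (D.color q) j (D.code u)}
    {k : D.Valid (fun _ => ι q) v} {k' : D.fits (ι q) (D.color q) j' (D.code v)}
    (H : ∀ i, j ≤ i → i < j' → ¬ D.Full (ι q) (D.color q) i)
    (H' : ¬ D.Full (ι q) (D.color q) j' ∨ v = []) :
    (Set.Icc (consWord (ι := ι) q j u h h') (consWord q j' v k k')).Finite := by
  let S : ℕ → Set (List (Q ×ₗ ℕ)) := fun i =>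
    {w | j ≤ i ∧ D.fits (ι q) (D.color q) i (D.code w) ∧ (i = j' → w ≤ v)}
  have hS : ∀ i ∈ Set.Iic j', (List.cons (toLex (q, i)) '' S i).Finite := by
    intro i hi
    refine Set.Finite.image _ ?_
    by_cases hij : j ≤ i
    · by_cases hf : D.Full (ι q) (D.color q) i
      · rcases (Set.mem_Iic.1 hi).eq_or_lt with rfl | hi
        · obtain rfl := H'.resolve_left (not_not_intro hf)
          exact (Set.finite_singleton []).subset fun w hw => eq_nil_of_le_nil (hw.2.2 rfl)
        · exact absurd hf (H i hij hi)
      · exact (finite_fits hf).subset fun w hw => hw.2.1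
    · exact Set.finite_empty.subset fun w hw => hij hw.1
  refine Set.Finite.of_finite_image (f := Subtype.val)
    (((Set.finite_Iic j').biUnion hS).subset ?_) Subtype.val_injective.injOn
  rintro _ ⟨x, ⟨hx, hx'⟩, rfl⟩
  obtain ⟨q', i, w, h1, h2, rfl⟩ := exists_eq_consWord x
  obtain rfl : q' = q := le_antisymm (top_le_of_le hx') (top_le_of_le hx)
  rw [← not_lt, consWord_lt_iff] at hx hx'
  simp only [lt_irrefl, false_or, true_and, not_or, not_and, not_lt] at hx hx'
  refine Set.mem_biUnion (Set.mem_Iic.2 hx'.1) ⟨w, ⟨hx.1, h2, fun hi => hx'.2 hi.symm⟩, rfl⟩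

/-- A proper extension of a letter at a full place lies in a copy, where induction applies. A letter
alone that comes after a full place is itself a root. In the remaining case only finitely many words
separate the element from `(q, 0)`. -/
theorem exists_root (x : D.Words ι) : ∃ x₀, IsRoot x₀ ∧ ∃ k, spSucc^[k] x₀ = x := by
  obtain ⟨l, hl, hl'⟩ := x
  induction l generalizing ι with
  | nil => exact absurd rfl hl
  | cons a u ih =>
    obtain ⟨q, j, rfl⟩ : ∃ q j, a = toLex (q, j) := ⟨_, _, rfl⟩
    have hl1 : D.Valid (fun _ => ι q) u := hl'.1
    have hl2 : D.fits (ι q) (D.color q) j (D.code u) := hl'.2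
    show ∃ x₀, IsRoot x₀ ∧ ∃ k, spSucc^[k] x₀ = consWord (D := D) (ι := ι) q j u hl1 hl2
    by_cases hA : D.Full (ι q) (D.color q) j ∧ u ≠ []
    · obtain ⟨y, hy, k, hk⟩ := ih (ι := fun _ => ι q) hA.2 hl1
      refine ⟨lift q j hA.1 y, isRoot_apply _ (ordConnected_range_lift _ _ _) hy, k, ?_⟩
      rw [spSucc_iterate_apply _ (ordConnected_range_lift q j hA.1), hk]
      rfl
    · by_cases hB : ∃ i < j, D.Full (ι q) (D.color q) i
      · obtain ⟨i, hij, hi⟩ := hB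
        obtain ⟨j, rfl⟩ : ∃ j', j = j' + 1 := ⟨j - 1, by omega⟩
        obtain rfl : u = [] := by
          by_contra hu
          exact hA ⟨hi.mono hij.le, hu⟩
        exact ⟨_, isRoot_single_succ (hi.mono (Nat.lt_succ_iff.1 hij)), 0, rfl⟩
      · push Not at hB
        refine ⟨base D ι q, isRoot_base q, exists_iterate_of_finite_Icc ?_
          (finite_Icc_consWord (h := valid_nil) (h' := by rw [D.code_nil]; exact fits_zero)
            (fun i _ hi => hB i hi) ?_)⟩
        · rw [← not_lt, base, single, consWord_lt_iff]
          simp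
        · rwa [not_and_or, not_ne_iff] at hA

theorem not_hasSucc_even {q : Q} {k : ℕ} (hq : D.color q = 2 * k)
    (h : D.fits (ι q) (D.color q) k 0) : ¬ HasSucc (single (D := D) (ι := ι) q k h) := by
  rintro ⟨y, hy⟩
  obtain ⟨q', j, v, h1, h2, rfl⟩ := exists_eq_consWord y
  obtain rfl : q = q' := top_eq_of_covBy hy
  have hlt := hy.lt
  rw [hq, D.fits_even, ← D.code_nil, D.code_injective.eq_iff] at h2
  rw [single, consWord_lt_iff] at hlt
  simp only [lt_irrefl, false_or, true_and, h2.2, and_false, or_false] at hlt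
  omega

/-- Within a letter of even colour the block ends at its last place. For odd colour the absence of
ω-blocks provides a first full place, and the one-letter word there is the last of its block.
Elements inside a copy are treated by induction. -/
theorem exists_not_hasSucc (x : D.Words ι) (hx : ¬ D.HasOmega (ι (top x))) :
    ∃ k, ¬ HasSucc (spSucc^[k] x) := by
  obtain ⟨l, hl, hl'⟩ := x
  induction l generalizing ι with
  | nil => exact absurd rfl hl
  | cons a u ih =>
    obtain ⟨q, j, rfl⟩ : ∃ q j, a = toLex (q, j) := ⟨_, _, rfl⟩
    have hl1 : D.Valid (fun _ => ι q) u := hl'.1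
    have hl2 : D.fits (ι q) (D.color q) j (D.code u) := hl'.2
    replace hx : ¬ D.HasOmega (ι q) := hx
    show ∃ k, ¬ HasSucc (spSucc^[k] (consWord (D := D) (ι := ι) q j u hl1 hl2))
    by_cases hf : D.Full (ι q) (D.color q) j
    · by_cases hu : u = []
      · subst hu
        exact ⟨0, not_hasSucc_single hf⟩
      · obtain ⟨k, hk⟩ := ih (ι := fun _ => ι q) hu hl1 hx
        refine ⟨k, fun h => hk ?_⟩
        have hoc := ordConnected_range_lift (D := D) (ι := ι) q j hf
        have e := spSucc_iterate_apply _ hoc k ⟨u, hu, hl1⟩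
        exact (hasSucc_apply_iff _ hoc).1 (e ▸ h)
    · obtain ⟨m, hm | hm⟩ := Nat.even_or_odd' (D.color q)
      · have h0 : D.fits (ι q) (D.color q) m 0 := by rw [hm, D.fits_even]; simp
        have h2 := hl2
        have hjm : j ≤ m ∧ u = [] := by
          rwa [hm, D.fits_even, ← D.code_nil, D.code_injective.eq_iff] at h2
        obtain ⟨k, hk⟩ := exists_iterate_of_finite_Icc
          (x := consWord (D := D) (ι := ι) q j u hl1 hl2) (y := single q m h0)
          (by
            rw [← not_lt, single, consWord_lt_iff]
            simp [hjm])
          (finite_Icc_consWord (fun i _ _ hi => by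
            obtain ⟨n, hn⟩ := hi.exists_odd
            omega) (Or.inr rfl))
        exact ⟨k, hk ▸ not_hasSucc_even hm h0⟩
      · have hex : ∃ i, D.Full (ι q) (D.color q) i := by
          by_contra! h
          exact hx ⟨m, hm ▸ h⟩
        classical
        have hfind := Nat.find_spec hex
        have hlt : j < Nat.find hex := by
          by_contra! h
          exact hf (hfind.mono h)
        obtain ⟨k, hk⟩ := exists_iterate_of_finite_Icc
          (x := consWord (D := D) (ι := ι) q j u hl1 hl2) (y := single q _ (hfind 0))
          (consWord_lt_iff.2 (Or.inr ⟨rfl, Or.inl hlt⟩)).le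
          (finite_Icc_consWord (fun i _ hi => Nat.find_min hex hi) (Or.inr rfl))
        exact ⟨k, hk ▸ not_hasSucc_single hfind⟩

/-- Without full places, only finitely many words lie between an element and a later one-letter word
with the same `q`, so a successor exists; taking it does not change `q`. -/
theorem hasSucc_iterate_base_odd {q : Q} {m : ℕ} (hq : D.color q = 2 * m + 1)
    (hm : ∀ j, ¬ D.Full (ι q) (2 * m + 1) j) (k : ℕ) :
    HasSucc (spSucc^[k] (base D ι q)) := by
  have key : ∀ x : D.Words ι, top x = q → HasSucc x := by
    intro x hx
    obtain ⟨q', j, u, h1, h2, rfl⟩ := exists_eq_consWord x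
    obtain rfl : q' = q := hx
    have hlt : consWord q' j u h1 h2 <
        single (ι := ι) q' (j + 1) (by rw [hq]; exact D.fits_odd_zero _ _ _) :=
      consWord_lt_iff.2 (Or.inr ⟨rfl, Or.inl (Nat.lt_succ_self j)⟩)
    obtain ⟨z, hz, -⟩ := exists_covBy_of_finite_Icc hlt
      (finite_Icc_consWord (fun i _ _ => hq ▸ hm i) (Or.inr rfl))
    exact ⟨z, hz⟩
  exact key _ (top_iterate k _)

/-- The words starting with `q` are exactly `(q, 0), …, (q, n)`, a block of `n + 1` points. -/
theorem hasSucc_iterate_base_even {q : Q} {n : ℕ} (hq : D.color q = 2 * n) (k : ℕ) :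
    HasSucc (spSucc^[k] (base D ι q)) ↔ k < n := by
  have hfit : ∀ k ≤ n, D.fits (ι q) (D.color q) k 0 := by
    intro k hk
    rw [hq, D.fits_even]
    exact ⟨hk, rfl⟩
  have hcov : ∀ k, ∀ hk : k + 1 ≤ n, single (D := D) (ι := ι) q k (hfit k (Nat.le_of_succ_le hk)) ⋖
      single q (k + 1) (hfit _ hk) := by
    refine fun k hk => ⟨consWord_lt_iff.2 (Or.inr ⟨rfl, Or.inl (Nat.lt_succ_self k)⟩), ?_⟩
    intro x hx hx'
    obtain ⟨q', j, u, h1, h2, rfl⟩ := exists_eq_consWord x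
    obtain rfl : q' = q := le_antisymm (top_le_of_le hx'.le) (top_le_of_le hx.le)
    rw [hq, D.fits_even, ← D.code_nil, D.code_injective.eq_iff] at h2
    rw [single, consWord_lt_iff] at hx hx'
    simp [h2.2] at hx hx'
    omega
  have hit : ∀ k, ∀ hk : k ≤ n, spSucc^[k] (base D ι q) = single q k (hfit k hk) := by
    intro k
    induction k with
    | zero => exact fun _ => rfl
    | succ k ih =>
      intro hk
      rw [Function.iterate_succ_apply', ih (Nat.le_of_succ_le hk)]
      exact spSucc_eq_of_covBy (hcov k hk)
  constructor
  · intro h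
    by_contra! h'
    have htop := not_hasSucc_even hq (hfit n le_rfl)
    have : ∀ i, spSucc^[n + i] (base D ι q) = single q n (hfit n le_rfl) := by
      intro i
      induction i with
      | zero => exact hit n le_rfl
      | succ i ih =>
        rw [← Nat.add_assoc, Function.iterate_succ_apply', ih]
        exact spSucc_eq_self htop
    obtain ⟨i, rfl⟩ := Nat.exists_eq_add_of_le h'
    exact htop (this i ▸ h)
  · intro h
    rw [hit k h.le]
    exact ⟨_, hcov k h⟩

end WordData

end Words

section Shuffle

namespace WordData

variable {Q : Type} [LinearOrder Q] {D : WordData Q} {ι : Q → ℕ}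

/-- `ι` is constant immediately to the right of each point. -/
def RightConst (ι : Q → ℕ) : Prop :=
  ∀ p, ∃ p', p < p' ∧ ∀ r, p < r → r < p' → ι r = ι p

/-- Blocks with successor pattern `τ` are available at all places between `q` and `q'`. -/
def Avail (D : WordData Q) (ι : Q → ℕ) (τ : ℕ → Prop) (q q' : Q) : Prop :=
  (∃ n, ∀ k, τ k ↔ k < n) ∨
    ((∀ k, τ k) ∧ ∀ p, q ≤ p → p ≤ q' → (∃ m, D.color p = 2 * m + 1) → D.HasOmega (ι p))

/-- `y` is the first element of a block with successor pattern `τ`. -/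
def RootOf {α : Type*} [LinearOrder α] (τ : ℕ → Prop) (y : α) : Prop :=
  IsRoot y ∧ ∀ k, HasSucc (spSucc^[k] y) ↔ τ k

theorem rightConst_const (D : WordData Q) (i : ℕ) : RightConst fun _ : Q => i := fun p =>
  (D.exists_above 0 p).imp fun _ h => ⟨h.1, fun _ _ _ => rfl⟩

theorem exists_rootOf_base {τ : ℕ → Prop} {q q' : Q} (hι : RightConst ι)
    (h : D.Avail ι τ q q') (hq : q < q') :
    ∃ p, q < p ∧ p < q' ∧ RootOf τ (base D ι p) := by
  rcases h with ⟨n, hn⟩ | ⟨hτ, hT⟩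
  · obtain ⟨p, hp, hp', hc⟩ := D.exists_between (2 * n) q q' hq
    exact ⟨p, hp, hp', isRoot_base p, fun k => by rw [hasSucc_iterate_base_even hc, hn]⟩
  -- Colour 1 is just some odd colour, needed to apply `hT` and obtain `m`. A point of colour `2 * m
  -- + 1` is then taken so close to the right of `p` that the index is still `ι p`.
  · obtain ⟨p, hp, hp', hc⟩ := D.exists_between 1 q q' hq
    obtain ⟨m, hm⟩ := hT p hp.le hp'.le ⟨0, hc⟩
    obtain ⟨r, hr, hr'⟩ := hι p
    obtain ⟨p₂, h₂, h₂', hc₂⟩ := D.exists_between (2 * m + 1) p (min r q') (lt_min hr hp')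
    have hιp : ι p₂ = ι p := hr' p₂ h₂ (h₂'.trans_le (min_le_left _ _))
    exact ⟨p₂, hp.trans h₂, h₂'.trans_le (min_le_right _ _), isRoot_base p₂, fun k =>
      iff_of_true (hasSucc_iterate_base_odd hc₂ (hιp ▸ hm) k) (hτ k)⟩

theorem RootOf.lift {τ : ℕ → Prop} {q : Q} {j : ℕ} (h : D.Full (ι q) (D.color q) j)
    {y : D.Words fun _ => ι q} (hy : RootOf τ y) : RootOf τ (lift q j h y) := by
  have hoc := ordConnected_range_lift (D := D) (ι := ι) q j h
  refine ⟨isRoot_apply _ hoc hy.1, fun k => ?_⟩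
  rw [spSucc_iterate_apply _ hoc, hasSucc_apply_iff _ hoc, hy.2]

theorem exists_rootOf_lift {τ : ℕ → Prop} {q : Q} {j : ℕ} (h : D.Full (ι q) (D.color q) j)
    (hτ : ∀ r r', D.Avail (fun _ => ι q) τ r r') {r r' : Q} (hr : r < r') :
    ∃ p, r < p ∧ p < r' ∧ ∃ y : D.Words ι, RootOf τ y ∧
      ∀ k, ∃ i w h1 h2, spSucc^[k] y = consWord q j (toLex (p, i) :: w) h1 h2 := by
  obtain ⟨p, hp, hp', hy⟩ := exists_rootOf_base (rightConst_const D (ι q)) (hτ r r') hr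
  refine ⟨p, hp, hp', _, hy.lift h, fun k => ?_⟩
  rw [spSucc_iterate_apply _ (ordConnected_range_lift q j h)]
  have ht : top (spSucc^[k] (base D (fun _ => ι q) p)) = p := top_iterate k _
  obtain ⟨p', i, w, h1, h2, e⟩ := exists_eq_consWord (spSucc^[k] (base D (fun _ => ι q) p))
  rw [e] at ht ⊢
  obtain rfl : p' = p := ht
  exact ⟨i, w, _, _, lift_apply q j h _⟩

/-- If `b` is not an iterate of `a`, infinitely many words lie between them. Either the first
components differ and density of colours suffices, or a full place provides a copy of a whole word
order in which to insert the block, directly or by induction on `a`. -/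
theorem exists_rootOf_between {τ : ℕ → Prop} (hι : RightConst ι) {a b : D.Words ι}
    (hτ : D.Avail ι τ (top a) (top b)) (hab : a < b) (hnear : ∀ k, spSucc^[k] a ≠ b) :
    ∃ y, RootOf τ y ∧ a < y ∧ ∀ k, spSucc^[k] y < b := by
  obtain ⟨l, hl, hl'⟩ := a
  induction l generalizing ι with
  | nil => exact absurd rfl hl
  | cons c u ih =>
    obtain ⟨q, j, rfl⟩ : ∃ q j, c = toLex (q, j) := ⟨_, _, rfl⟩
    have h1 : D.Valid (fun _ => ι q) u := hl'.1
    have h2 : D.fits (ι q) (D.color q) j (D.code u) := hl'.2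
    replace hτ : D.Avail ι τ q (top b) := hτ
    replace hab : consWord q j u h1 h2 < b := hab
    replace hnear : ∀ k, spSucc^[k] (consWord q j u h1 h2) ≠ b := hnear
    show ∃ y, RootOf τ y ∧ consWord q j u h1 h2 < y ∧ ∀ k, spSucc^[k] y < b
    have hinf : ¬ (Set.Icc (consWord q j u h1 h2) b).Finite := fun h => by
      obtain ⟨k, hk⟩ := exists_iterate_of_finite_Icc hab.le h
      exact hnear k hk
    rcases (top_le_of_le hab.le).lt_or_eq with hq | hq
    · obtain ⟨p, hp, hp', hy⟩ := exists_rootOf_base hι hτ hq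
      refine ⟨_, hy, lt_of_top_lt hp, fun k => lt_of_top_lt ?_⟩
      rwa [top_iterate, top_base]
    obtain ⟨q', j', v, h3, h4, rfl⟩ := exists_eq_consWord b
    obtain rfl : q = q' := hq
    -- Full places occur only at odd colours, so availability at `q` gives ω-blocks for the constant
    -- index `ι q` of the copy, if the pattern is infinite.
    have hτ' : ∀ i, D.Full (ι q) (D.color q) i → ∀ r r', D.Avail (fun _ => ι q) τ r r' :=
      fun i hi _ _ => hτ.imp_right fun H =>
        ⟨H.1, fun _ _ _ _ => H.2 q le_rfl le_rfl hi.exists_odd⟩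
    rw [consWord_lt_iff] at hab
    simp only [lt_irrefl, false_or, true_and] at hab
    -- Here `b` lies in the copy after `(q, j')` and `a` does not lie in that copy; the block is
    -- inserted low in the copy, below `v`.
    by_cases hJ : D.Full (ι q) (D.color q) j' ∧ v ≠ [] ∧ (j < j' ∨ u = [])
    · obtain ⟨hf, hv, hu⟩ := hJ
      obtain ⟨r, hr⟩ := exists_forall_cons_lt hv
      obtain ⟨r₀, hr₀, -⟩ := D.exists_below 0 r
      obtain ⟨p, -, hp, y, hy, hk⟩ := exists_rootOf_lift hf (hτ' j' hf) hr₀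
      refine ⟨y, hy, ?_, fun k => ?_⟩
      · obtain ⟨i, w, e1, e2, e⟩ := hk 0
        rw [show y = _ from e, consWord_lt_iff]
        refine Or.inr ⟨rfl, ?_⟩
        rcases hab with hab | hab
        · exact Or.inl hab
        · refine hu.imp_right fun hu => ⟨hab.1, ?_⟩
          rw [hu]
          exact List.nil_lt_cons _ _
      · obtain ⟨i, w, e1, e2, e⟩ := hk k
        rw [e, consWord_lt_iff]
        exact Or.inr ⟨rfl, Or.inr ⟨rfl, hr p hp _ _⟩⟩
    rcases hab with hlt | ⟨rfl, huv⟩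
    -- Now place `j'` contributes finitely many words up to `b`, so some earlier place from `j` on
    -- is full, hence also `j' - 1`. The block is inserted high in the copy after `(q, j' - 1)`,
    -- above `u` in case `j = j' - 1`.
    · have hex : D.Full (ι q) (D.color q) (j' - 1) := by
        by_contra hf
        refine hinf (finite_Icc_consWord (fun i _ hi h => hf (h.mono (by omega))) ?_)
        by_contra! hv
        exact hJ ⟨hv.1, hv.2, Or.inl hlt⟩
      obtain ⟨r, hr⟩ := exists_forall_lt_cons q u
      obtain ⟨r₁, hr₁, -⟩ := D.exists_above 0 r
      obtain ⟨p, hp, -, y, hy, hk⟩ := exists_rootOf_lift hex (hτ' _ hex) hr₁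
      refine ⟨y, hy, ?_, fun k => ?_⟩
      · obtain ⟨i, w, e1, e2, e⟩ := hk 0
        rw [show y = _ from e, consWord_lt_iff]
        refine Or.inr ⟨rfl, ?_⟩
        rcases (Nat.le_sub_one_of_lt hlt).lt_or_eq with h | h
        exacts [Or.inl h, Or.inr ⟨h, hr p hp _ _⟩]
      · obtain ⟨i, w, e1, e2, e⟩ := hk k
        rw [e, consWord_lt_iff]
        exact Or.inr ⟨rfl, Or.inl (by omega)⟩
    -- Same place and both tails nonempty: `a` and `b` lie in one copy, and induction applies to the
    -- tails.
    · have hf : D.Full (ι q) (D.color q) j := by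
        by_contra hf
        exact hinf (finite_Icc_consWord (fun i hi hi' => absurd hi' (not_lt_of_ge hi))
          (Or.inl hf))
      have hv : v ≠ [] := by
        rintro rfl
        exact List.not_lt_nil _ huv
      have hu : u ≠ [] := fun hu => hJ ⟨hf, hv, Or.inr hu⟩
      have hoc := ordConnected_range_lift (D := D) (ι := ι) q j hf
      obtain ⟨y, hy, hay, hyb⟩ := ih (ι := fun _ => ι q) (b := ⟨v, hv, h3⟩)
        (rightConst_const D (ι q)) hu h1 (hτ' j hf _ _) huv (fun k e => hnear k (by
          rw [lift_eq q j hf hu, spSucc_iterate_apply _ hoc, e]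
          rfl))
      refine ⟨lift q j hf y, hy.lift hf, ?_, fun k => ?_⟩
      · rw [lift_eq q j hf hu, OrderEmbedding.lt_iff_lt]
        exact hay
      · rw [lift_eq q j hf hv, spSucc_iterate_apply _ hoc, OrderEmbedding.lt_iff_lt]
        exact hyb k

/-- Separators between the intervals on which a monotone index function is constant. -/
structure Separators (D : WordData Q) (ι : Q → ℕ) where
  /-- The point separating the indices up to `i` from the larger ones. -/
  sep : ℕ → Q
  le_iff : ∀ p i, ι p ≤ i ↔ p < sep i
  index_sep : ∀ i, ι (sep i) = i + 1
  color_sep : ∀ i, D.color (sep i) = 0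

theorem Separators.monotone (S : Separators D ι) : Monotone ι := by
  intro p q hpq
  by_contra! h
  have hq := (S.le_iff q (ι q)).1 le_rfl
  exact absurd ((S.le_iff p (ι q)).2 (hpq.trans_lt hq)) (not_le_of_gt h)

theorem Separators.rightConst (S : Separators D ι) : RightConst ι := fun p =>
  ⟨S.sep (ι p), (S.le_iff _ _).1 le_rfl, fun _ hr hr' =>
    le_antisymm ((S.le_iff _ _).2 hr') (S.monotone hr.le)⟩

theorem Separators.exists_interval (S : Separators D ι) (i : ℕ) :
    ∃ q q', q < q' ∧ (∀ k < i, S.sep k ≤ q) ∧ ∀ p, q < p → p < q' → ι p = i := by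
  cases i with
  | zero =>
    obtain ⟨q, hq, -⟩ := D.exists_below 0 (S.sep 0)
    exact ⟨q, S.sep 0, hq, by simp, fun p _ hp => Nat.le_zero.1 ((S.le_iff _ _).2 hp)⟩
  | succ i =>
    refine ⟨S.sep i, S.sep (i + 1), (S.le_iff _ _).1 (S.index_sep i).le, fun k hk => ?_, fun p hp hp' =>
      le_antisymm ((S.le_iff _ _).2 hp') ?_⟩
    · by_contra! h
      have := (S.le_iff _ _).2 h
      rw [S.index_sep] at this
      omega
    exact (S.index_sep i).ge.trans (S.monotone hp.le)

theorem eventually_pattern {α : Type*} [LinearOrder α] (x : α) :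
    (∃ n, ∀ k, HasSucc (spSucc^[k] x) ↔ k < n) ∨ ∀ k, HasSucc (spSucc^[k] x) := by
  classical
  by_cases h : ∃ k, ¬ HasSucc (spSucc^[k] x)
  · refine Or.inl ⟨Nat.find h, fun k => ⟨fun hk => ?_, fun hk => not_not.1 (Nat.find_min h hk)⟩⟩
    by_contra! hle
    obtain ⟨i, rfl⟩ := Nat.exists_eq_add_of_le hle
    have key : ∀ i, spSucc^[Nat.find h + i] x = spSucc^[Nat.find h] x := by
      intro i
      induction i with
      | zero => rfl
      | succ i ih =>
        rw [← Nat.add_assoc, Function.iterate_succ_apply', ih]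
        exact spSucc_eq_self (Nat.find_spec h)
    rw [key i] at hk
    exact Nat.find_spec h hk
  · push Not at h
    exact Or.inr h

theorem base_top_le (x : D.Words ι) : base D ι (top x) ≤ x := by
  obtain ⟨q, j, u, h1, h2, rfl⟩ := exists_eq_consWord x
  rw [← not_lt, top_consWord, base, single, consWord_lt_iff]
  simp

/-- The bounds are the maximum of `A` and the minimum of `B`. For an empty set a point with strictly
smaller or larger first component is used, which is never in the same block. -/
theorem exists_bounds {A B : Set (D.Words ι)} (q : Q) (hA : A.Finite) (hB : B.Finite)
    (hAB : ∀ a ∈ A, ∀ b ∈ B, a < b ∧ ∀ k, spSucc^[k] a ≠ b) :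
    ∃ a b : D.Words ι, (∀ x ∈ A, x ≤ a) ∧ (∀ x ∈ B, b ≤ x) ∧ a < b ∧ ∀ k, spSucc^[k] a ≠ b := by
  have hfar : ∀ a b : D.Words ι, top a < top b → a < b ∧ ∀ k, spSucc^[k] a ≠ b := by
    refine fun a b h => ⟨lt_of_top_lt h, fun k e => h.ne ?_⟩
    rw [← e, top_iterate]
  have h1 : ∃ a : D.Words ι, (∀ x ∈ A, x ≤ a) ∧ ∀ b ∈ B, a < b ∧ ∀ k, spSucc^[k] a ≠ b := by
    rcases A.eq_empty_or_nonempty with rfl | hne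
    · rcases B.eq_empty_or_nonempty with rfl | hne
      · exact ⟨base D ι q, by simp, by simp⟩
      · obtain ⟨b, -, hb'⟩ := Set.exists_min_image B top hB hne
        obtain ⟨p, hp, -⟩ := D.exists_below 0 (top b)
        exact ⟨base D ι p, by simp, fun x hx => hfar _ _ (hp.trans_le (hb' x hx))⟩
    · obtain ⟨a, ha, ha'⟩ := Set.exists_max_image A id hA hne
      exact ⟨a, ha', hAB a ha⟩
  obtain ⟨a, ha, hab⟩ := h1
  rcases B.eq_empty_or_nonempty with rfl | hne
  · obtain ⟨p, hp, -⟩ := D.exists_above 0 (top a)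
    exact ⟨a, base D ι p, ha, by simp, hfar _ _ hp⟩
  · obtain ⟨b, hb, hb'⟩ := Set.exists_min_image B id hB hne
    exact ⟨a, b, ha, hb', hab b hb⟩

/-- Fixing the separators below `N` confines a new block to its own section when the section has
index below `N`; all later sections contain ω-blocks, so there is no difference between them to
respect. -/
theorem spExt_of_forall_ge (S : Separators D ι) {N : ℕ} (hN : ∀ i, N ≤ i → D.HasOmega i) :
    SpExt {x : D.Words ι | ∃ i < N, x = base D ι (S.sep i)} := by
  refine spExt_of_shuffle exists_root fun x₀ hx₀ A B hA hB hAB hE => ?_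
  obtain ⟨a, b, ha, hb, hab, hnear⟩ := exists_bounds (top x₀) hA hB hAB
  have hav : D.Avail ι (fun k => HasSucc (spSucc^[k] x₀)) (top a) (top b) := by
    refine (eventually_pattern x₀).imp_right fun hinf => ⟨hinf, fun p hp hp' hodd => ?_⟩
    have hx : D.HasOmega (ι (top x₀)) := by
      by_contra h
      obtain ⟨k, hk⟩ := exists_not_hasSucc x₀ h
      exact hk (hinf k)
    -- Each fixed separator lies on the same side of `p` as of `x₀`. The case where `p` is itself
    -- the separator bounding the interval from above is excluded by colour: separators have colour
    -- 0 and `p` is odd.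
    have key : ∀ i < N, ι p ≤ i ↔ ι (top x₀) ≤ i := by
      intro i hi
      rw [S.le_iff, S.le_iff]
      rcases hE _ ⟨i, hi, rfl⟩ with ⟨he, he'⟩ | ⟨he, he'⟩
      · exact iff_of_false (not_lt_of_ge ((top_le_of_le (ha _ he)).trans hp))
          (not_lt_of_ge (top_le_of_le he'.le))
      · refine iff_of_true ?_ ?_
        · refine lt_of_le_of_ne (hp'.trans (top_le_of_le (hb _ he))) fun e => ?_
          obtain ⟨m, hm⟩ := hodd
          have := S.color_sep i
          rw [e] at hm
          omega
        · refine lt_of_le_of_ne (top_le_of_le he'.le) fun e => ?_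
          have := base_top_le x₀
          rw [e] at this
          exact absurd he' (not_lt_of_ge this)
    by_cases hp : ι p < N
    · have h1 := (key _ hp).1 le_rfl
      rwa [le_antisymm ((key _ (h1.trans_lt hp)).2 le_rfl) h1]
    · exact hN _ (not_lt.1 hp)
  obtain ⟨y, hy, hay, hyb⟩ := exists_rootOf_between S.rightConst hav hab hnear
  exact ⟨y, hy.1, fun k => (hy.2 k).symm, fun x hx => (ha x hx).trans_lt hay,
    fun x hx k => (hyb k).trans_le (hb x hx)⟩

theorem spAct_base {q : Q} (hq : D.color q = 0) (w : List Bool) :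
    spAct (base D ι q) w = base D ι q := by
  have hs : ∀ b, spStep b (base D ι q) = base D ι q := by
    intro b
    cases b
    · exact spPred_eq_self fun ⟨y, hy⟩ => isRoot_base q y hy
    · exact spSucc_eq_self fun h =>
        absurd ((hasSucc_iterate_base_even (n := 0) hq 0).1 h) (lt_irrefl 0)
  induction w with
  | nil => rfl
  | cons b w ih => rw [spAct_cons, hs, ih]

/-- An interval between two one-point blocks of a section with ω-blocks is mapped to one of a
section without, fixing `E` below. This is a partial isomorphism, but a root of an ω-block inside
the first interval has no possible image. -/
theorem not_spExt {E : Set (D.Words ι)} (hE : E.Finite) (hι : RightConst ι) {q₁ q₂ q₃ q₄ : Q}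
    (h₁₂ : q₁ < q₂) (hbad : ∀ p, q₁ < p → p < q₂ → ¬ D.HasOmega (ι p))
    (h₃₄ : q₃ < q₄) (hgood : ∀ p, q₃ < p → p < q₄ → D.HasOmega (ι p))
    (hE₁ : ∀ e ∈ E, top e ≤ q₁) (hE₃ : ∀ e ∈ E, top e ≤ q₃) : ¬ SpExt E := by
  intro hext
  -- Colour 0 gives one-point blocks, which `s` and `p` leave fixed, so the four end points generate
  -- only themselves.
  obtain ⟨a, ha, ha', hac⟩ := D.exists_between 0 _ _ h₁₂
  obtain ⟨b, hb, hb', hbc⟩ := D.exists_between 0 _ _ ha'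
  obtain ⟨a', ha₃, ha₄, hac'⟩ := D.exists_between 0 _ _ h₃₄
  obtain ⟨b', hb₃, hb₄, hbc'⟩ := D.exists_between 0 _ _ ha₄
  obtain ⟨p, hp, hp', hpr⟩ := exists_rootOf_base (D := D) (τ := fun _ => True) hι
    (Or.inr ⟨fun _ => trivial, fun p h h' _ => hgood p (ha₃.trans_le h) (h'.trans_lt hb₄)⟩) hb₃
  let l : List (D.Words ι × D.Words ι) :=
    (base D ι a', base D ι a) :: (base D ι b', base D ι b) :: hE.toFinset.toList.map fun e => (e, e)
  have hl : ∀ u ∈ l, u = (base D ι a', base D ι a) ∨ u = (base D ι b', base D ι b) ∨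
      ∃ e ∈ E, u = (e, e) := by
    intro u hu
    simpa [l, eq_comm] using hu
  have hlow : ∀ e ∈ E, ∀ w, ∀ q, top e < q → spAct e w < base D ι q := fun e he w q hq =>
    (isRoot_base q).spAct_lt (lt_of_top_lt hq) w
  have hab : base D ι a < base D ι b := lt_of_top_lt hb
  have hab' : base D ι a' < base D ι b' := lt_of_top_lt hb₃
  have hiso : SpIso l := by
    intro u hu v hv w w'
    rcases hl u hu with rfl | rfl | ⟨e, he, rfl⟩ <;> rcases hl v hv with rfl | rfl | ⟨e', he', rfl⟩
    all_goals simp only [spAct_base, hac, hbc, hac', hbc', le_refl]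
    · exact iff_of_true hab'.le hab.le
    · exact iff_of_false (hlow e' he' w' a' ((hE₃ _ he').trans_lt ha₃)).not_ge
        (hlow e' he' w' a ((hE₁ _ he').trans_lt ha)).not_ge
    · exact iff_of_false hab'.not_ge hab.not_ge
    · exact iff_of_false (hlow e' he' w' b' ((hE₃ _ he').trans_lt (ha₃.trans hb₃))).not_ge
        (hlow e' he' w' b ((hE₁ _ he').trans_lt (ha.trans hb))).not_ge
    · exact iff_of_true (hlow e he w a' ((hE₃ _ he).trans_lt ha₃)).le
        (hlow e he w a ((hE₁ _ he).trans_lt ha)).le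
    · exact iff_of_true (hlow e he w b' ((hE₃ _ he).trans_lt (ha₃.trans hb₃))).le
        (hlow e he w b ((hE₁ _ he).trans_lt (ha.trans hb))).le
  obtain ⟨d, hd⟩ := hext l (fun e he => by simp [l, he]) hiso (base D ι p)
  have hda : base D ι a < d := (hd.lt_iff (u := (base D ι a', base D ι a))
    (v := (base D ι p, d)) (by simp [l]) (by simp)).1 (lt_of_top_lt hp)
  have hdb : d < base D ι b := (hd.lt_iff (u := (base D ι p, d))
    (v := (base D ι b', base D ι b)) (by simp) (by simp [l])).1 (lt_of_top_lt hp')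
  obtain ⟨k, hk⟩ := exists_not_hasSucc d
    (hbad _ (ha.trans_le (top_le_of_le hda.le)) ((top_le_of_le hdb.le).trans_lt hb'))
  -- The orbit of `d` under `s` stalls, and an isomorphism would make the orbit of the ω-root stall
  -- as well.
  have hfix : spSucc^[k + 1] d = spSucc^[k] d := by
    rw [Function.iterate_succ_apply']
    exact spSucc_eq_self hk
  have := (hd.eq_iff (u := (base D ι p, d)) (v := (base D ι p, d)) (by simp) (by simp)
    (List.replicate (k + 1) true) (List.replicate k true)).2 (by
      rw [spAct_replicate, spAct_replicate]
      exact hfix)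
  rw [spAct_replicate, spAct_replicate] at this
  change spSucc^[k + 1] (base D ι p) = spSucc^[k] (base D ι p) at this
  rw [Function.iterate_succ_apply'] at this
  exact ((hpr.2 k).2 trivial).covBy.lt.ne' this

theorem spExt_empty_iff (S : Separators D ι) (hinf : ∃ᶠ i in Filter.atTop, D.HasOmega i) :
    SpExt (∅ : Set (D.Words ι)) ↔ ∀ i, D.HasOmega i := by
  constructor
  · intro h i
    by_contra hi
    obtain ⟨j, hj⟩ := hinf.exists
    obtain ⟨q₁, q₂, h₁₂, -, H₁₂⟩ := S.exists_interval i
    obtain ⟨q₃, q₄, h₃₄, -, H₃₄⟩ := S.exists_interval j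
    exact not_spExt Set.finite_empty S.rightConst h₁₂ (fun p hp hp' => by rwa [H₁₂ p hp hp'])
      h₃₄ (fun p hp hp' => by rwa [H₃₄ p hp hp']) (by simp) (by simp) h
  · intro h
    simpa using spExt_of_forall_ge S (N := 0) fun i _ => h i

theorem exists_spExt_iff (S : Separators D ι) (hinf : ∃ᶠ i in Filter.atTop, D.HasOmega i) :
    (∃ E : Finset (D.Words ι), SpExt (E : Set (D.Words ι))) ↔
      ∀ᶠ i in Filter.atTop, D.HasOmega i := by
  classical
  constructor
  · rintro ⟨E, h⟩
    by_contra hfin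
    rw [Filter.not_eventually] at hfin
    -- All elements of `E` lie below the separator `S.sep M`, while sections of both kinds occur
    -- beyond it.
    let M := E.sup fun e => ι (top e)
    have hM : ∀ e ∈ E, top e < S.sep M := fun e he =>
      (S.le_iff _ _).1 (Finset.le_sup (f := fun e => ι (top e)) he)
    obtain ⟨i, hi, hi'⟩ := Filter.frequently_atTop.1 hfin (M + 1)
    obtain ⟨j, hj, hj'⟩ := Filter.frequently_atTop.1 hinf (M + 1)
    obtain ⟨q₁, q₂, h₁₂, H₁, H₁₂⟩ := S.exists_interval i
    obtain ⟨q₃, q₄, h₃₄, H₃, H₃₄⟩ := S.exists_interval j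
    exact not_spExt E.finite_toSet S.rightConst h₁₂ (fun p hp hp' => by rwa [H₁₂ p hp hp'])
      h₃₄ (fun p hp hp' => by rwa [H₃₄ p hp hp']) (fun e he => (hM e he).le.trans (H₁ M hi))
      (fun e he => (hM e he).le.trans (H₃ M hj)) h
  · intro h
    obtain ⟨N, hN⟩ := Filter.eventually_atTop.1 h
    refine ⟨(Finset.range N).image fun i => base D ι (S.sep i), ?_⟩
    convert spExt_of_forall_ge S hN using 1
    ext x
    simp [eq_comm]

end WordData

end Shuffle

/-! ### Indices for computably enumerable suborders -/

section Enumeration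

variable {α β : Type} [Primcodable α] [Primcodable β]

@[fun_prop] theorem Computable.unpair_comp {f : α → ℕ} (hf : Computable f) :
    Computable fun a => (f a).unpair := Primrec.unpair.to_comp.comp hf

@[fun_prop] theorem Computable.encode_comp {f : α → β} (hf : Computable f) :
    Computable fun a => Encodable.encode (f a) := Computable.encode.comp hf

theorem ComputablePred.exists_bool {p : α → Prop} (h : ComputablePred p) :
    ∃ f : α → Bool, Computable f ∧ ∀ a, p a ↔ f a = true :=
  computablePred_iff_exists_bool.1 h

/-- The `k`-th element of a uniformly computable family of infinite sets. -/
theorem computable_nth {p : α → ℕ → Prop} (h : ComputablePred fun x : α × ℕ => p x.1 x.2)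
    (hinf : ∀ a, {n | p a n}.Infinite) : Computable fun x : α × ℕ => Nat.nth (p x.1) x.2 := by
  classical
  obtain ⟨f, hf, e⟩ := h.exists_bool
  have hcount : Computable fun x : α × ℕ => Nat.count (p x.1) x.2 := by
    refine (Computable.nat_rec (α := α × ℕ) (σ := ℕ) (f := fun x => x.2) (g := fun _ => 0)
      (h := fun x y => y.2 + bif f (x.1, y.1) then 1 else 0) (by fun_prop) (by fun_prop)
      (Computable.add_comp (by fun_prop) (Computable.cond (hf.comp (by fun_prop))
        (Computable.const 1) (Computable.const 0)))).of_eq ?_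
    rintro ⟨a, n⟩
    induction n with
    | zero => simp
    | succ n ih =>
      have := e (a, n)
      simp only at ih this
      rw [Nat.count_succ, ← ih]
      by_cases h : p a n
      · simp [h, this.1 h]
      · have h' : f (a, n) = false := by simpa [h] using this
        simp [h, h']
  -- The `k`-th element is found by searching for a member with exactly `k` members below it.
  have hdec : ComputablePred fun y : (α × ℕ) × ℕ =>
      p y.1.1 y.2 ∧ Nat.count (p y.1.1) y.2 = y.1.2 :=
    ComputablePred.and (h.comp (f := fun y : (α × ℕ) × ℕ => (y.1.1, y.2)) (by fun_prop))
      (ComputablePred.eq (hcount.comp (f := fun x : α × ℕ => Nat.count (p x.1) x.2)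
        (g := fun y : (α × ℕ) × ℕ => (y.1.1, y.2)) (by fun_prop)) (by fun_prop))
  obtain ⟨g, hg, e'⟩ := hdec.exists_bool
  have hpart : Partrec₂ fun (x : α × ℕ) (n : ℕ) => (Part.some (g (x, n)) : Part Bool) :=
    hg.partrec
  refine (Partrec.rfind hpart).of_eq fun x => ?_
  refine Part.eq_some_iff.2 (Nat.mem_rfind.2 ⟨?_, fun {m} hm => ?_⟩)
  · have := (e' (x, Nat.nth (p x.1) x.2)).1
      ⟨Nat.nth_mem_of_infinite (hinf x.1) x.2, Nat.count_nth_of_infinite (hinf x.1) x.2⟩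
    simp [this]
  · have : ¬ g (x, m) = true := by
      rw [← e']
      rintro ⟨h1, h2⟩
      exact hm.ne ((Nat.nth_count h1).symm.trans (congrArg (Nat.nth (p x.1)) h2))
    simpa using this

/-- Uniformly computable ordering relations have a computable function giving their indices. -/
theorem exists_index {r : ℕ → ℕ → ℕ → Prop}
    (h : ComputablePred fun x : ℕ × ℕ × ℕ => r x.1 x.2.1 x.2.2) :
    ∃ e : ℕ → ℕ, Computable e ∧ ∀ (x : ℕ) (o : LinearOrder ℕ),
      (∀ a b, o.le a b ↔ r x a b) → DefinesLinearOrder (e x) o := by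
  classical
  obtain ⟨f, hf, hfr⟩ := h.exists_bool
  let g : ℕ → ℕ := fun n => bif f (n.unpair.1, n.unpair.2.unpair) then 1 else 0
  have hg : Computable g :=
    Computable.cond (hf.comp (by fun_prop)) (Computable.const 1) (Computable.const 0)
  obtain ⟨c, hc⟩ := Nat.Partrec.Code.exists_code.1 (Partrec.nat_iff.1 hg.partrec)
  refine ⟨fun x => Encodable.encode (c.curry x), ?_, fun x o ho a b => ?_⟩
  · exact Computable.encode.comp
      (Nat.Partrec.Code.primrec₂_curry.to_comp.comp (Computable.const c) Computable.id)
  · rw [phi, Denumerable.ofNat_encode, Nat.Partrec.Code.eval_curry, hc]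
    have : f (x, a, b) = true ↔ o.le a b := ((ho a b).trans (hfr (x, a, b))).symm
    by_cases hab : o.le a b
    · simp [g, hab, this.2 hab]
    · have h' : f (x, a, b) = false := by simpa [hab] using this
      simp [g, hab, h']

/-- Uniformly computably enumerable infinite suborders of a computable linear order have a
computable function giving indices of isomorphic orders. -/
theorem exists_index_of_suborder [Inhabited β] [LinearOrder β]
    (hle : ComputablePred fun x : β × β => x.1 ≤ x.2) {S : ℕ → β → Prop}
    (hS : SigmaPred 1 fun x : ℕ × β => S x.1 x.2) (hinf : ∀ x, {u | S x u}.Infinite) :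
    ∃ e : ℕ → ℕ, Computable e ∧ ∀ x, ∃ o : LinearOrder ℕ, DefinesLinearOrder (e x) o ∧
      Nonempty (@OrderIso ℕ {u // S x u} o.toLE _) := by
  obtain ⟨q, hq, e⟩ := hS
  replace hq : ComputablePred q := by simpa using ComputablePred.not hq
  let val : ℕ → β := fun n => (Encodable.decode n.unpair.1).getD default
  have hval : Computable val :=
    Primrec.option_getD_default.to_comp.comp (Computable.decode.comp (by fun_prop))
  -- An element is represented by its code paired with its least witness of membership, so it has
  -- exactly one representative. The first clause discards numbers whose first component decodes to
  -- nothing and would be read as `default`.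
  let G : ℕ → ℕ → Prop := fun x n => Encodable.encode (val n) = n.unpair.1 ∧
    q ((x, val n), n.unpair.2) ∧ ∀ t < n.unpair.2, ¬ q ((x, val n), t)
  have hG : ComputablePred fun y : ℕ × ℕ => G y.1 y.2 := by
    refine ComputablePred.and (ComputablePred.eq (by fun_prop) (by fun_prop))
      (ComputablePred.and (hq.comp (by fun_prop)) ?_)
    exact (ComputablePred.ball_lt (α := ℕ × ℕ) (p := fun y t => ¬ q ((y.1, val y.2), t))
      (hq.not.comp (by fun_prop))).comp (f := fun y : ℕ × ℕ => (y, y.2.unpair.2)) (by fun_prop)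
  have hex : ∀ x u, S x u → ∃ n, G x n ∧ val n = u := by
    intro x u hu
    classical
    have hu' := (e (x, u)).1 hu
    have hv : val (Nat.pair (Encodable.encode u) (Nat.find hu')) = u := by simp [val]
    refine ⟨Nat.pair (Encodable.encode u) (Nat.find hu'), ⟨?_, ?_, ?_⟩, hv⟩
    · rw [hv, Nat.unpair_pair]
    · rw [hv, Nat.unpair_pair]
      exact Nat.find_spec hu'
    · rw [hv, Nat.unpair_pair]
      exact fun t ht => Nat.find_min hu' ht
  have hinj : ∀ x n n', G x n → G x n' → val n = val n' → n = n' := by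
    intro x n n' h h' hv
    rw [← Nat.pair_unpair n, ← Nat.pair_unpair n', ← h.1, ← h'.1, hv]
    congr 1
    have h2 := h.2
    rw [hv] at h2
    refine le_antisymm (not_lt.1 fun hlt => ?_) (not_lt.1 fun hlt => ?_)
    exacts [h2.2 _ hlt h'.2.1, h'.2.2 _ hlt h2.1]
  have hGinf : ∀ x, {n | G x n}.Infinite := by
    intro x hfin
    refine hinf x ((hfin.image val).subset fun u hu => ?_)
    obtain ⟨n, hn, hn'⟩ := hex x u hu
    exact ⟨n, hn, hn'⟩
  have hnth := computable_nth hG hGinf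
  let F : ∀ x, ℕ → {u // S x u} := fun x k => ⟨val (Nat.nth (G x) k),
    (e (x, _)).2 ⟨_, (Nat.nth_mem_of_infinite (hGinf x) k).2.1⟩⟩
  have hF : ∀ x, Function.Bijective (F x) := by
    intro x
    constructor
    · intro k k' h
      exact Nat.nth_injective (hGinf x) (hinj x _ _ (Nat.nth_mem_of_infinite (hGinf x) k)
        (Nat.nth_mem_of_infinite (hGinf x) k') (congrArg Subtype.val h))
    · rintro ⟨u, hu⟩
      obtain ⟨n, hn, hn'⟩ := hex x u hu
      classical
      exact ⟨Nat.count (G x) n, Subtype.ext (by simp only [F]; rw [Nat.nth_count hn, hn'])⟩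
  obtain ⟨i, hi, hi'⟩ := exists_index (r := fun x a b =>
    val (Nat.nth (G x) a) ≤ val (Nat.nth (G x) b)) (hle.comp
      ((hval.comp (hnth.comp (f := fun y : ℕ × ℕ => Nat.nth (G y.1) y.2)
        (g := fun x : ℕ × ℕ × ℕ => (x.1, x.2.1)) (by fun_prop))).pair
      (hval.comp (hnth.comp (f := fun y : ℕ × ℕ => Nat.nth (G y.1) y.2)
        (g := fun x : ℕ × ℕ × ℕ => (x.1, x.2.2)) (by fun_prop)))))
  refine ⟨i, hi, fun x => ⟨LinearOrder.lift' (F x) (hF x).1, hi' x _ fun a b => Iff.rfl, ?_⟩⟩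
  exact ⟨⟨Equiv.ofBijective (F x) (hF x), Iff.rfl⟩⟩

end Enumeration

/-! ### Positive dyadic rationals -/

section Dyadic

/-- Positive dyadic rationals `a / 2 ^ b` in lowest terms, as pairs `(a, b)`. -/
def PosDyadic : Type := {x : ℕ × ℕ // x.1 ≠ 0 ∧ (x.1 % 2 = 1 ∨ x.2 = 0)}

namespace PosDyadic

/-- The numerator. -/
def num (x : PosDyadic) : ℕ := x.1.1

/-- The exponent of the denominator. -/
def exp (x : PosDyadic) : ℕ := x.1.2

/-- The numerical value. -/
def value (x : PosDyadic) : ℚ := x.num / 2 ^ x.exp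

theorem value_lt_iff {x y : PosDyadic} :
    x.value < y.value ↔ x.num * 2 ^ y.exp < y.num * 2 ^ x.exp := by
  rw [value, value, div_lt_div_iff₀ (by positivity) (by positivity)]
  norm_cast

theorem value_injective : Function.Injective value := by
  have key : ∀ x y : PosDyadic, x.num * 2 ^ y.exp = y.num * 2 ^ x.exp → ¬ x.exp < y.exp := by
    intro x y h hlt
    have hy : y.num % 2 = 1 := y.2.2.resolve_right (by
      change ¬ y.exp = 0
      omega)
    obtain ⟨d, hd⟩ := Nat.exists_eq_add_of_lt hlt
    have h' : x.num * 2 ^ (d + 1) = y.num := by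
      rw [hd, show x.exp + d + 1 = (d + 1) + x.exp by ring, pow_add, ← mul_assoc] at h
      exact Nat.eq_of_mul_eq_mul_right (by positivity) h
    rw [← h', pow_succ, ← mul_assoc] at hy
    omega
  intro x y h
  have h' : x.num * 2 ^ y.exp = y.num * 2 ^ x.exp := by
    rw [value, value, div_eq_div_iff (by positivity) (by positivity)] at h
    exact_mod_cast h
  have he : x.exp = y.exp := by
    have h1 := key x y h'
    have h2 := key y x h'.symm
    omega
  have hn : x.num = y.num := by
    rw [he] at h'
    exact Nat.eq_of_mul_eq_mul_right (by positivity) h'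
  exact Subtype.ext (Prod.ext hn he)

noncomputable instance : LinearOrder PosDyadic := LinearOrder.lift' value value_injective

theorem lt_iff {x y : PosDyadic} : x < y ↔ x.num * 2 ^ y.exp < y.num * 2 ^ x.exp :=
  value_lt_iff

theorem primrecPred_lowestTerms :
    PrimrecPred fun x : ℕ × ℕ => x.1 ≠ 0 ∧ (x.1 % 2 = 1 ∨ x.2 = 0) :=
  (Primrec.eq.comp Primrec.fst (Primrec.const 0)).not.and
    ((Primrec.eq.comp (Primrec.nat_mod.comp Primrec.fst (Primrec.const 2)) (Primrec.const 1)).or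
      (Primrec.eq.comp Primrec.snd (Primrec.const 0)))

instance : Primcodable PosDyadic := Primcodable.subtype primrecPred_lowestTerms

instance : Inhabited PosDyadic := ⟨⟨(1, 0), by simp⟩⟩

variable {α : Type} [Primcodable α]

theorem primrec_val : Primrec fun x : PosDyadic => x.1 :=
  Primrec.subtype_val (hp := primrecPred_lowestTerms)

@[fun_prop] theorem computable_num {f : α → PosDyadic} (hf : Computable f) :
    Computable fun a => (f a).num := Computable.fst.comp (primrec_val.to_comp.comp hf)

@[fun_prop] theorem computable_exp {f : α → PosDyadic} (hf : Computable f) :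
    Computable fun a => (f a).exp := Computable.snd.comp (primrec_val.to_comp.comp hf)

/-- The dyadic rational `a / 2 ^ b` in lowest terms. -/
def ofPair (a b : ℕ) (h : a ≠ 0 ∧ (a % 2 = 1 ∨ b = 0)) : PosDyadic := ⟨(a, b), h⟩

/-- The colour of a dyadic rational, a function of its denominator. -/
def color (x : PosDyadic) : ℕ := x.exp.unpair.1

/-- The integer part. -/
def floor (x : PosDyadic) : ℕ := x.num / 2 ^ x.exp

/-- The positive integer `i + 1`. -/
def ofNatSucc (i : ℕ) : PosDyadic := ofPair (i + 1) 0 (by simp)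

theorem exists_color_between (k : ℕ) (q q' : PosDyadic) (h : q < q') :
    ∃ p, q < p ∧ p < q' ∧ p.color = k := by
  rw [lt_iff] at h
  -- The point is `q + 2 ^ (-b)`. The first component of `b` makes its colour `k`; the second makes
  -- `2 ^ (-b)` smaller than the gap, which is at least `2 ^ (-(q.exp + q'.exp))`, and makes the
  -- numerator odd.
  let b := Nat.pair k (q.exp + q'.exp + 1)
  have hb : q.exp + q'.exp + 1 ≤ b := Nat.right_le_pair _ _
  obtain ⟨d, hd⟩ := Nat.exists_eq_add_of_le hb
  refine ⟨ofPair (q.num * 2 ^ (b - q.exp) + 1) b ⟨by simp, Or.inl ?_⟩, ?_, ?_, ?_⟩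
  · show (q.num * 2 ^ (b - q.exp) + 1) % 2 = 1
    rw [show b - q.exp = (b - q.exp - 1) + 1 by omega, pow_succ, ← mul_assoc]
    omega
  · rw [lt_iff]
    show q.num * 2 ^ b < (q.num * 2 ^ (b - q.exp) + 1) * 2 ^ q.exp
    rw [add_mul, mul_assoc, ← pow_add, Nat.sub_add_cancel (by omega)]
    have : 0 < 2 ^ q.exp := by positivity
    omega
  · rw [lt_iff]
    show (q.num * 2 ^ (b - q.exp) + 1) * 2 ^ q'.exp < q'.num * 2 ^ b
    have h1 : b - q.exp = (d + 1) + q'.exp := by omega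
    have h2 : b = q.exp + (d + 1) + q'.exp := by omega
    rw [h1, h2, pow_add _ (q.exp + (d + 1)), ← mul_assoc]
    refine Nat.mul_lt_mul_of_pos_right ?_ (by positivity)
    have h3 := Nat.mul_le_mul_right (2 ^ (d + 1)) (Nat.succ_le_of_lt h)
    have h4 : 2 ≤ 2 ^ (d + 1) := by
      rw [pow_succ]
      have : 0 < 2 ^ d := by positivity
      omega
    rw [pow_add, pow_add _ q.exp, mul_comm (2 ^ (d + 1)), ← mul_assoc, ← mul_assoc]
    rw [Nat.succ_mul] at h3
    omega
  · show b.unpair.1 = k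
    simp [b]

theorem exists_color_below (k : ℕ) (q : PosDyadic) : ∃ p, p < q ∧ p.color = k := by
  have hb : q.exp + 1 ≤ Nat.pair k (q.exp + 1) := Nat.right_le_pair _ _
  refine ⟨ofPair 1 (Nat.pair k (q.exp + 1)) (by simp), ?_, ?_⟩
  · rw [lt_iff]
    show 1 * 2 ^ q.exp < q.num * 2 ^ (Nat.pair k (q.exp + 1))
    have hq : 1 ≤ q.num := Nat.one_le_iff_ne_zero.2 q.2.1
    have h2 : 2 ^ q.exp < 2 ^ (Nat.pair k (q.exp + 1)) := Nat.pow_lt_pow_right (by norm_num) hb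
    exact (Nat.mul_lt_mul_of_pos_left h2 one_pos).trans_le (Nat.mul_le_mul_right _ hq)
  · show (Nat.pair k (q.exp + 1)).unpair.1 = k
    simp

theorem exists_color_above (k : ℕ) (q : PosDyadic) : ∃ p, q < p ∧ p.color = k := by
  have h : q < ofNatSucc q.num := by
    rw [lt_iff]
    show q.num * 2 ^ 0 < (q.num + 1) * 2 ^ q.exp
    have : 0 < 2 ^ q.exp := by positivity
    nlinarith
  obtain ⟨p, hp, -, hc⟩ := exists_color_between k _ _ h
  exact ⟨p, hp, hc⟩

theorem floor_le_iff (p : PosDyadic) (i : ℕ) : p.floor ≤ i ↔ p < ofNatSucc i := by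
  rw [lt_iff, floor, ← Nat.lt_succ_iff, Nat.div_lt_iff_lt_mul (by positivity)]
  show _ ↔ p.num * 2 ^ 0 < (i + 1) * 2 ^ p.exp
  rw [pow_zero, mul_one]

end PosDyadic

end Dyadic

/-! ### Computability of the word order -/

section ComputableWords

variable {α β : Type} [Primcodable α] [Primcodable β]

instance : Primcodable (PosDyadic ×ₗ ℕ) := inferInstanceAs (Primcodable (PosDyadic × ℕ))

instance : Inhabited (PosDyadic ×ₗ ℕ) := ⟨toLex (default, 0)⟩

theorem Computable.ofLex_fst_comp {f : α → PosDyadic ×ₗ ℕ} (hf : Computable f) :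
    Computable fun a => (ofLex (f a)).1 := 
  (Computable.fst (α := PosDyadic) (β := ℕ)).comp hf

theorem Computable.ofLex_snd_comp {f : α → PosDyadic ×ₗ ℕ} (hf : Computable f) :
    Computable fun a => (ofLex (f a)).2 := 
  (Computable.snd (α := PosDyadic) (β := ℕ)).comp hf

@[fun_prop] theorem Computable.mul_comp {f g : α → ℕ} (hf : Computable f) (hg : Computable g) :
    Computable fun a => f a * g a := Primrec.nat_mul.to_comp.comp hf hg

@[fun_prop] theorem Computable.div_comp {f g : α → ℕ} (hf : Computable f) (hg : Computable g) :
    Computable fun a => f a / g a := Primrec.nat_div.to_comp.comp hf hg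

@[fun_prop] theorem Computable.mod_comp {f g : α → ℕ} (hf : Computable f) (hg : Computable g) :
    Computable fun a => f a % g a := Primrec.nat_mod.to_comp.comp hf hg

@[fun_prop] theorem Computable.pow_comp {f g : α → ℕ} (hf : Computable f) (hg : Computable g) :
    Computable fun a => f a ^ g a :=
  (Primrec₂.unpaired'.1 Nat.Primrec.pow).to_comp.comp hf hg

@[fun_prop] theorem Computable.take_comp {f : α → ℕ} {g : α → List β} (hf : Computable f)
    (hg : Computable g) : Computable fun a => (g a).take (f a) :=
  Primrec.list_take.to_comp.comp hf hg

@[fun_prop] theorem Computable.drop_comp {f : α → ℕ} {g : α → List β} (hf : Computable f)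
    (hg : Computable g) : Computable fun a => (g a).drop (f a) :=
  Primrec.list_drop.to_comp.comp hf hg

theorem ComputablePred.posDyadic_lt {f g : α → PosDyadic} (hf : Computable f)
    (hg : Computable g) : ComputablePred fun a => f a < g a := by
  simp only [PosDyadic.lt_iff]
  exact ComputablePred.lt (by fun_prop) (by fun_prop)

theorem ComputablePred.letter_lt {f g : α → PosDyadic ×ₗ ℕ} (hf : Computable f)
    (hg : Computable g) : ComputablePred fun a => f a < g a := by
  simp only [Prod.Lex.lt_iff]
  exact (ComputablePred.posDyadic_lt hf.ofLex_fst_comp hg.ofLex_fst_comp).or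
    ((ComputablePred.eq hf.ofLex_fst_comp hg.ofLex_fst_comp).and
      (ComputablePred.lt hf.ofLex_snd_comp hg.ofLex_snd_comp))

/-- The bounded existential quantifier is written as a negated bounded universal one, and agreement
before `i` as equality of prefixes, so that `ComputablePred.ball_lt` applies. -/
theorem list_lt_iff_exists_take {γ : Type*} [LinearOrder γ] (d : γ) (u v : List γ) :
    u < v ↔ (u = v.take u.length ∧ u.length < v.length) ∨ ¬ ∀ i < u.length,
      ¬ (i < v.length ∧ u.take i = v.take i ∧ u.getD i d < v.getD i d) := by
  rw [List.lt_iff_exists]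
  refine or_congr Iff.rfl ?_
  push Not
  refine exists_congr fun i => ⟨?_, ?_⟩
  · rintro ⟨h1, h2, h3, h4⟩
    refine ⟨h1, h2, ?_, by rwa [List.getD_eq_getElem _ _ h1, List.getD_eq_getElem _ _ h2]⟩
    refine List.ext_getElem (by simp; omega) fun j hj hj' => ?_
    rw [List.getElem_take, List.getElem_take]
    exact h3 j (by simp at hj; omega)
  · rintro ⟨h1, h2, h3, h4⟩
    rw [List.getD_eq_getElem _ _ h1, List.getD_eq_getElem _ _ h2] at h4
    refine ⟨h1, h2, fun j hj => ?_, h4⟩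
    have := congrArg (fun l => l[j]?) h3
    simp only [List.getElem?_take, hj, if_true] at this
    rw [List.getElem?_eq_getElem (hj.trans h1), List.getElem?_eq_getElem (hj.trans h2)] at this
    exact Option.some.inj this

theorem ComputablePred.list_le {γ : Type} [Primcodable γ] [LinearOrder γ] [Inhabited γ]
    (h : ComputablePred fun x : γ × γ => x.1 < x.2) :
    ComputablePred fun x : List γ × List γ => x.1 ≤ x.2 := by
  have hlt : ComputablePred fun x : List γ × List γ => x.2 < x.1 := by
    have h0 : ComputablePred fun y : (List γ × List γ) × ℕ =>
        y.1.2.getD y.2 default < y.1.1.getD y.2 default :=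
      h.comp (f := fun y : (List γ × List γ) × ℕ =>
        (y.1.2.getD y.2 default, y.1.1.getD y.2 default)) (by fun_prop)
    have h1 : ComputablePred fun y : (List γ × List γ) × ℕ => ¬ (y.2 < y.1.1.length ∧
        y.1.2.take y.2 = y.1.1.take y.2 ∧ y.1.2.getD y.2 default < y.1.1.getD y.2 default) :=
      ComputablePred.not ((ComputablePred.lt (by fun_prop) (by fun_prop)).and
        ((ComputablePred.eq (by fun_prop) (by fun_prop)).and h0))
    have h2 := (ComputablePred.ball_lt (α := List γ × List γ)
      (p := fun x i => ¬ (i < x.1.length ∧ x.2.take i = x.1.take i ∧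
        x.2.getD i default < x.1.getD i default)) h1).comp
          (f := fun x : List γ × List γ => (x, x.2.length)) (by fun_prop)
    have h3 : ComputablePred fun x : List γ × List γ => x.2 = x.1.take x.2.length ∧
        x.2.length < x.1.length :=
      (ComputablePred.eq (by fun_prop) (by fun_prop)).and
        (ComputablePred.lt (by fun_prop) (by fun_prop))
    exact (h3.or h2.not).of_eq fun x => (list_lt_iff_exists_take default x.2 x.1).symm
  exact hlt.not.of_eq fun x => not_lt

theorem computablePred_word_le :
    ComputablePred fun x : List (PosDyadic ×ₗ ℕ) × List (PosDyadic ×ₗ ℕ) => x.1 ≤ x.2 :=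
  ComputablePred.list_le (ComputablePred.letter_lt Computable.fst Computable.snd)

end ComputableWords

/-! ### The word order of a `Σ⁰₄` predicate -/

section WordOrder

/-- All numbers below `n` have been refuted as witnesses at some place up to `j`. -/
def Refuted (V : ℕ → ℕ → ℕ → ℕ → ℕ → Prop) (i m j n : ℕ) : Prop :=
  ∃ j', j' ≤ j ∧ ∀ y < n, ∃ z, ¬ V i m j' y z

/-- The word data of the predicate `∃ m, ∀ j, ∃ y, ∀ z, V i m j y z`. -/
noncomputable def dyadicWordData (V : ℕ → ℕ → ℕ → ℕ → ℕ → Prop) : WordData PosDyadic where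
  color := PosDyadic.color
  exists_between := PosDyadic.exists_color_between
  exists_below := PosDyadic.exists_color_below
  exists_above := PosDyadic.exists_color_above
  code := Encodable.encode
  code_injective := Encodable.encode_injective
  code_nil := rfl
  fits i c j n := (c % 2 = 0 ∧ j ≤ c / 2 ∧ n = 0) ∨ (c % 2 = 1 ∧ Refuted V i (c / 2) j n)
  fits_even i k j n := by
    rw [Nat.mul_mod_right, Nat.mul_div_cancel_left k two_pos]
    simp
  fits_odd_zero i m j := Or.inr ⟨by omega, 0, Nat.zero_le _, by simp⟩
  fits_odd_antitone i m j n n' hn := by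
    rintro (⟨h, -⟩ | ⟨h, j', hj, H⟩)
    · omega
    · exact Or.inr ⟨h, j', hj, fun y hy => H y (hy.trans_le hn)⟩
  fits_odd_mono i m j j' n hj := by
    rintro (⟨h, -⟩ | ⟨h, j₀, hj₀, H⟩)
    · omega
    · exact Or.inr ⟨h, j₀, hj₀.trans hj, H⟩

/-- The integers separate the values of the integer part. -/
def dyadicSeparators (V : ℕ → ℕ → ℕ → ℕ → ℕ → Prop) :
    WordData.Separators (dyadicWordData V) PosDyadic.floor where
  sep := PosDyadic.ofNatSucc
  le_iff := PosDyadic.floor_le_iff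
  index_sep i := by
    show (i + 1) / 2 ^ 0 = i + 1
    simp
  color_sep i := by
    show (Nat.unpair 0).1 = 0
    simp

/-- If place `j` has no valid `y`, all numbers are refuted there and the place is full. Conversely,
a bound beyond valid choices for all places up to `j` can never be refuted, so `j` is not full. -/
theorem hasOmega_dyadicWordData (V : ℕ → ℕ → ℕ → ℕ → ℕ → Prop) (i : ℕ) :
    (dyadicWordData V).HasOmega i ↔ ∃ m, ∀ j, ∃ y, ∀ z, V i m j y z := by
  have hfull : ∀ m j, (dyadicWordData V).Full i (2 * m + 1) j ↔ ∀ n, Refuted V i m j n := by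
    refine fun m j => forall_congr' fun n => ?_
    show (_ ∨ _) ↔ _
    rw [show (2 * m + 1) / 2 = m by omega]
    have h1 : (2 * m + 1) % 2 = 1 := by omega
    simp [h1]
  refine exists_congr fun m => ?_
  simp only [hfull, Refuted]
  push Not
  constructor
  · intro h j
    obtain ⟨n, hn⟩ := h j
    obtain ⟨y, -, hy⟩ := hn j le_rfl
    exact ⟨y, hy⟩
  · intro h j
    choose f hf using h
    -- Refutation may use any place up to `j`, so the bound must exceed the witness at each of them.
    refine ⟨(Finset.range (j + 1)).sup f + 1, fun j' hj' => ⟨f j', ?_, hf j'⟩⟩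
    exact Nat.lt_succ_of_le (Finset.le_sup (f := f) (Finset.mem_range.2 (Nat.lt_succ_of_le hj')))

theorem WordData.valid_const_iff {Q : Type} [LinearOrder Q] (D : WordData Q) (d : Q ×ₗ ℕ) (i : ℕ)
    (u : List (Q ×ₗ ℕ)) : D.Valid (fun _ => i) u ↔ ∀ t < u.length,
      D.fits i (D.color (ofLex (u.getD t d)).1) (ofLex (u.getD t d)).2
        (D.code (u.drop (t + 1))) := by
  induction u with
  | nil => simp [Valid]
  | cons a u ih =>
    rw [Valid, ih, List.length_cons, Nat.forall_lt_succ_left', and_comm]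
    simp

/-- The index of the first letter governs the whole word, so the recursion unwinds into a bounded
quantifier over suffixes, which keeps validity c.e. -/
theorem WordData.valid_iff {Q : Type} [LinearOrder Q] (D : WordData Q) (d : Q ×ₗ ℕ) (ι : Q → ℕ)
    (u : List (Q ×ₗ ℕ)) : D.Valid ι u ↔ ∀ t < u.length,
      D.fits (ι (ofLex (u.getD 0 d)).1) (D.color (ofLex (u.getD t d)).1) (ofLex (u.getD t d)).2
        (D.code (u.drop (t + 1))) := by
  rw [← valid_const_iff]
  cases u <;> rfl

variable {α : Type} [Primcodable α]

theorem sigmaPred_refuted {V : ℕ → ℕ → ℕ → ℕ → ℕ → ℕ → Prop}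
    (hV : ComputablePred fun x : ℕ × ℕ × ℕ × ℕ × ℕ × ℕ =>
      V x.1 x.2.1 x.2.2.1 x.2.2.2.1 x.2.2.2.2.1 x.2.2.2.2.2) {x i m j n : α → ℕ}
    (hx : Computable x) (hi : Computable i) (hm : Computable m) (hj : Computable j)
    (hn : Computable n) :
    SigmaPred 1 fun a => Refuted (V (x a)) (i a) (m a) (j a) (n a) := by
  refine SigmaPred.ex (SigmaPred.and (ComputablePred.le (by fun_prop) (by fun_prop)).sigma ?_)
  have hz : ComputablePred fun y : ((α × ℕ) × ℕ) × ℕ =>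
      ¬ V (x y.1.1.1) (i y.1.1.1) (m y.1.1.1) y.1.1.2 y.1.2 y.2 :=
    hV.not.comp (f := fun y : ((α × ℕ) × ℕ) × ℕ =>
      (x y.1.1.1, i y.1.1.1, m y.1.1.1, y.1.1.2, y.1.2, y.2)) (by fun_prop)
  have := SigmaPred.ball_lt (α := α × ℕ)
    (p := fun b y => ∃ z, ¬ V (x b.1) (i b.1) (m b.1) b.2 y z) (SigmaPred.ex hz.sigma)
  exact this.comp (f := fun b : α × ℕ => (b, n b.1)) (by fun_prop)

theorem sigmaPred_dyadicWordData_valid {V : ℕ → ℕ → ℕ → ℕ → ℕ → ℕ → Prop}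
    (hV : ComputablePred fun x : ℕ × ℕ × ℕ × ℕ × ℕ × ℕ =>
      V x.1 x.2.1 x.2.2.1 x.2.2.2.1 x.2.2.2.2.1 x.2.2.2.2.2) :
    SigmaPred 1 fun x : ℕ × List (PosDyadic ×ₗ ℕ) =>
      x.2 ≠ [] ∧ (dyadicWordData (V x.1)).Valid PosDyadic.floor x.2 := by
  refine SigmaPred.and (ComputablePred.not (ComputablePred.eq (by fun_prop) (by fun_prop))).sigma ?_
  have hl : Computable fun y : (ℕ × List (PosDyadic ×ₗ ℕ)) × ℕ => y.1.2.getD y.2 default := by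
    fun_prop
  have h0 : Computable fun y : (ℕ × List (PosDyadic ×ₗ ℕ)) × ℕ => y.1.2.getD 0 default := by
    fun_prop
  have hc : Computable fun y : (ℕ × List (PosDyadic ×ₗ ℕ)) × ℕ =>
      PosDyadic.color (ofLex (y.1.2.getD y.2 default)).1 :=
    Computable.fst.comp (Computable.unpair_comp (PosDyadic.computable_exp hl.ofLex_fst_comp))
  have hj := hl.ofLex_snd_comp
  have hf : Computable fun y : (ℕ × List (PosDyadic ×ₗ ℕ)) × ℕ =>
      PosDyadic.floor (ofLex (y.1.2.getD 0 default)).1 :=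
    Computable.div_comp (PosDyadic.computable_num h0.ofLex_fst_comp)
      (Computable.pow_comp (by fun_prop) (PosDyadic.computable_exp h0.ofLex_fst_comp))
  have hn : Computable fun y : (ℕ × List (PosDyadic ×ₗ ℕ)) × ℕ =>
      Encodable.encode (y.1.2.drop (y.2 + 1)) := by fun_prop
  have hc2 := Computable.mod_comp hc (Computable.const 2)
  have hd2 := Computable.div_comp hc (Computable.const 2)
  have := SigmaPred.ball_lt (α := ℕ × List (PosDyadic ×ₗ ℕ))
    (p := fun x t => (dyadicWordData (V x.1)).fits (PosDyadic.floor (ofLex (x.2.getD 0 default)).1)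
      (PosDyadic.color (ofLex (x.2.getD t default)).1) (ofLex (x.2.getD t default)).2
      (Encodable.encode (x.2.drop (t + 1))))
    (SigmaPred.or
      ((ComputablePred.eq hc2 (Computable.const 0)).and
        ((ComputablePred.le hj hd2).and (ComputablePred.eq hn (Computable.const 0)))).sigma
      (SigmaPred.and (ComputablePred.eq hc2 (Computable.const 1)).sigma
        (sigmaPred_refuted hV (Computable.fst.comp Computable.fst) hf hd2 hj hn)))
  exact (this.comp (f := fun x : ℕ × List (PosDyadic ×ₗ ℕ) => (x, x.2.length))
    (by fun_prop)).of_iff fun x => WordData.valid_iff _ default _ _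

end WordOrder

/-! ### Reductions -/

section Reductions

open Filter

theorem SpExt.empty_orderIso_iff {α β : Type*} [LinearOrder α] [LinearOrder β] (e : α ≃o β) :
    SpExt (∅ : Set α) ↔ SpExt (∅ : Set β) :=
  ⟨fun h => by simpa using h.map_orderIso e, fun h => by simpa using h.map_orderIso e.symm⟩

theorem exists_spExt_orderIso_iff {α β : Type*} [LinearOrder α] [LinearOrder β] (e : α ≃o β) :
    (∃ E : Finset α, SpExt (E : Set α)) ↔ ∃ E : Finset β, SpExt (E : Set β) := by
  classical
  constructor
  · rintro ⟨E, hE⟩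
    exact ⟨E.image e, by simpa using hE.map_orderIso e⟩
  · rintro ⟨E, hE⟩
    exact ⟨E.image e.symm, by simpa using hE.map_orderIso e.symm⟩

theorem DefinesLinearOrder.unique {e : ℕ} {o o' : LinearOrder ℕ} (h : DefinesLinearOrder e o)
    (h' : DefinesLinearOrder e o') : o = o' :=
  LinearOrder.ext fun x y => (h.phiHalts_one x y).symm.trans (h'.phiHalts_one x y)

theorem mem_spHomogeneousIndices_iff {e : ℕ} {β : Type*} [LinearOrder β]
    (H : ∃ o : LinearOrder ℕ, DefinesLinearOrder e o ∧ Nonempty (@OrderIso ℕ β o.toLE _)) :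
    e ∈ spHomogeneousIndices ↔ SpExt (∅ : Set β) := by
  obtain ⟨o, h, ⟨g⟩⟩ := H
  rw [← SpExt.empty_orderIso_iff g, ← @isSpHomogeneous_iff_spExt ℕ o]
  refine ⟨?_, fun ho => ⟨o, h, ho⟩⟩
  rintro ⟨o', h', ho⟩
  rwa [h.unique h']

theorem mem_weaklySpHomogeneousIndices_iff {e : ℕ} {β : Type*} [LinearOrder β]
    (H : ∃ o : LinearOrder ℕ, DefinesLinearOrder e o ∧ Nonempty (@OrderIso ℕ β o.toLE _)) :
    e ∈ weaklySpHomogeneousIndices ↔ ∃ E : Finset β, SpExt (E : Set β) := by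
  obtain ⟨o, h, ⟨g⟩⟩ := H
  rw [← exists_spExt_orderIso_iff g, ← @isWeaklySpHomogeneous_iff_spExt ℕ o]
  refine ⟨?_, fun ho => ⟨o, h, ho⟩⟩
  rintro ⟨o', h', ho⟩
  rwa [h.unique h']

/-- The word order of the matrix of `T` has ω-blocks in section `i` exactly when `T x i` holds; its
computable copy therefore translates both homogeneity notions into statements about `T x`. -/
theorem exists_reduction_of_frequently {T : ℕ → ℕ → Prop}
    (hT : SigmaPred 4 fun x : ℕ × ℕ => T x.1 x.2) (hinf : ∀ x, ∃ᶠ i in atTop, T x i) :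
    ∃ e : ℕ → ℕ, Computable e ∧ ∀ x, (e x ∈ spHomogeneousIndices ↔ ∀ i, T x i) ∧
      (e x ∈ weaklySpHomogeneousIndices ↔ ∀ᶠ i in atTop, T x i) := by
  obtain ⟨q₁, ⟨q₂, ⟨q₃, ⟨q₄, hq₄, e₄⟩, e₃⟩, e₂⟩, e₁⟩ := hT
  -- Each level of the hierarchy is the projection of a complement, so unfolding four levels gives
  -- `T x i` as ∃ m, ∀ j, ∃ y, ∀ z, `V x i m j y z`.
  let V : ℕ → ℕ → ℕ → ℕ → ℕ → ℕ → Prop := fun x i m j y z => ¬ q₄ (((((x, i), m), j), y), z)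
  have hV : ComputablePred fun x : ℕ × ℕ × ℕ × ℕ × ℕ × ℕ =>
      V x.1 x.2.1 x.2.2.1 x.2.2.2.1 x.2.2.2.2.1 x.2.2.2.2.2 :=
    ComputablePred.comp (p := fun x => ¬ q₄ x) hq₄ (f := fun x : ℕ × ℕ × ℕ × ℕ × ℕ × ℕ =>
      (((((x.1, x.2.1), x.2.2.1), x.2.2.2.1), x.2.2.2.2.1), x.2.2.2.2.2)) (by fun_prop)
  have hom : ∀ x i, (dyadicWordData (V x)).HasOmega i ↔ T x i := by
    intro x i
    have h3 : ∀ w, q₃ w ↔ ∀ z, ¬ q₄ (w, z) := fun w => by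
      rw [← not_exists, ← e₄, not_not]
    have h1 : ∀ w, q₁ w ↔ ∀ j, ¬ q₂ (w, j) := fun w => by
      rw [← not_exists, ← e₂, not_not]
    refine (hasOmega_dyadicWordData _ _).trans (Iff.trans ?_ (e₁ (x, i)).symm)
    simp only [h1, e₃, h3, V]
  obtain ⟨e, he, H⟩ := exists_index_of_suborder computablePred_word_le
    (sigmaPred_dyadicWordData_valid hV) fun x => by
      have : Nonempty ((dyadicWordData (V x)).Words PosDyadic.floor) :=
        ⟨WordData.base _ _ default⟩
      exact Set.infinite_coe_iff.1
        (NoMaxOrder.infinite (α := (dyadicWordData (V x)).Words PosDyadic.floor))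
  refine ⟨e, he, fun x => ?_⟩
  have hinf' : ∃ᶠ i in atTop, (dyadicWordData (V x)).HasOmega i := by simpa only [hom] using hinf x
  constructor
  · exact (mem_spHomogeneousIndices_iff (H x)).trans <| (WordData.spExt_empty_iff (dyadicSeparators (V x)) hinf').trans
      (forall_congr' fun i => hom x i)
  · refine (mem_weaklySpHomogeneousIndices_iff (H x)).trans <| (WordData.exists_spExt_iff (dyadicSeparators (V x)) hinf').trans ?_
    simp only [hom]

/-- Even indices are made true to guarantee infinitely many sections with ω-blocks, and index `2 * i
+ 1` carries `T x i`; this changes neither "for all" nor "for almost all". -/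
theorem exists_reduction {T : ℕ → ℕ → Prop} (hT : SigmaPred 4 fun x : ℕ × ℕ => T x.1 x.2) :
    ∃ e : ℕ → ℕ, Computable e ∧ ∀ x, (e x ∈ spHomogeneousIndices ↔ ∀ i, T x i) ∧
      (e x ∈ weaklySpHomogeneousIndices ↔ ∀ᶠ i in atTop, T x i) := by
  obtain ⟨e, he, H⟩ := exists_reduction_of_frequently
    (T := fun x i => i % 2 = 0 ∨ T x (i / 2))
    (SigmaPred.or (ComputablePred.eq (by fun_prop) (by fun_prop)).sigma
      (hT.comp (f := fun x : ℕ × ℕ => (x.1, x.2 / 2)) (by fun_prop)))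
    fun x => frequently_atTop.2 fun a => ⟨2 * a, by omega, Or.inl (by omega)⟩
  refine ⟨e, he, fun x => ⟨(H x).1.trans ⟨fun h i => ?_, fun h i => Or.inr (h _)⟩,
    (H x).2.trans ?_⟩⟩
  · have := (h (2 * i + 1)).resolve_left (by omega)
    rwa [show (2 * i + 1) / 2 = i by omega] at this
  · simp only [eventually_atTop]
    constructor
    · rintro ⟨a, ha⟩
      refine ⟨a, fun i hi => ?_⟩
      have := (ha (2 * i + 1) (by omega)).resolve_left (by omega)
      rwa [show (2 * i + 1) / 2 = i by omega] at this
    · rintro ⟨a, ha⟩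
      exact ⟨2 * a, fun i hi => Or.inr (ha _ (by omega))⟩

theorem manyOneReducible_spHomogeneousIndices {B : Set ℕ} (hB : IsPiZero 5 B) :
    (fun x => x ∈ B) ≤₀ fun x => x ∈ spHomogeneousIndices := by
  obtain ⟨q, hq, e⟩ := isPiZero_iff.1 hB
  obtain ⟨f, hf, H⟩ := exists_reduction (T := fun x i => ¬ q (x, i)) hq
  refine ⟨f, hf, fun x => ?_⟩
  show x ∈ B ↔ f x ∈ spHomogeneousIndices
  rw [(H x).1, ← not_exists, ← e x, not_not]

/-- With unique witnesses, these lists are the initial segments of a single sequence, one at most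
for each length. There are infinitely many exactly when the sequence never breaks off. This converts
∀ ∃ into "infinitely many". -/
theorem infinite_setOf_forall_getD_iff {β : Type*} {P : ℕ → β → Prop}
    (hP : ∀ t b b', P t b → P t b' → b = b') (d : β) :
    {l : List β | ∀ t, t < l.length → P t (l.getD t d)}.Infinite ↔ ∀ t, ∃ b, P t b := by
  constructor
  · intro hinf t
    by_contra ht
    refine hinf (Set.Finite.of_finite_image (f := List.length) ((Set.finite_Iic t).subset ?_) ?_)
    · rintro _ ⟨l, hl, rfl⟩
      exact not_lt.1 fun h => ht ⟨_, hl t h⟩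
    · intro l hl l' hl' hlen
      refine List.ext_getElem hlen fun i hi hi' => ?_
      have h := hl i hi
      have h' := hl' i hi'
      rw [List.getD_eq_getElem _ _ hi] at h
      rw [List.getD_eq_getElem _ _ hi'] at h'
      exact hP i _ _ h h'
  · intro h
    choose f hf using h
    refine Set.infinite_of_injective_forall_mem (f := fun n => (List.range n).map f) ?_ ?_
    · intro n n' hn
      simpa using congrArg List.length hn
    · intro n t ht
      rw [List.getD_eq_getElem _ _ ht]
      simpa using hf t

/-- The number `b.length` satisfies `∀ y, ¬ q (k, y)`, and the entries of `b` are the least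
counterexamples for the smaller numbers. -/
def LeastCounterexamples (q : ℕ → ℕ → Prop) (b : List ℕ) : Prop :=
  (∀ y, ¬ q b.length y) ∧
    ∀ k, k < b.length → q k (b.getD k 0) ∧ ∀ y, y < b.getD k 0 → ¬ q k y

theorem LeastCounterexamples.unique {q : ℕ → ℕ → Prop} {b b' : List ℕ}
    (h : LeastCounterexamples q b) (h' : LeastCounterexamples q b') : b = b' := by
  have hlen : b.length = b'.length := le_antisymm
    (not_lt.1 fun hlt => h'.1 _ (h.2 _ hlt).1) (not_lt.1 fun hlt => h.1 _ (h'.2 _ hlt).1)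
  refine List.ext_getElem hlen fun k hk hk' => ?_
  have h1 := h.2 k hk
  have h2 := h'.2 k hk'
  rw [List.getD_eq_getElem _ _ hk] at h1
  rw [List.getD_eq_getElem _ _ hk'] at h2
  exact le_antisymm (not_lt.1 fun hlt => h1.2 _ hlt h2.1) (not_lt.1 fun hlt => h2.2 _ hlt h1.1)

theorem exists_leastCounterexamples_iff {q : ℕ → ℕ → Prop} :
    (∃ b, LeastCounterexamples q b) ↔ ∃ k, ∀ y, ¬ q k y := by
  classical
  refine ⟨fun ⟨b, hb⟩ => ⟨_, hb.1⟩, fun h => ?_⟩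
  have hlt : ∀ k, k < Nat.find h → ∃ y, q k y := fun k hk => by
    simpa using Nat.find_min h hk
  choose! f hf using fun k hk => (⟨_, Nat.find_spec (hlt k hk), fun y => Nat.find_min (hlt k hk)⟩ :
    ∃ y, q k y ∧ ∀ y', y' < y → ¬ q k y')
  refine ⟨(List.range (Nat.find h)).map f, by simpa using Nat.find_spec h, fun k hk => ?_⟩
  rw [List.getD_eq_getElem _ _ hk]
  simpa using hf k (by simpa using hk)

/-- Merely asserting that the smaller numbers fail would cost an existential quantifier over
counterexamples. Recording the least ones in `b` removes it while keeping the witness unique. -/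
theorem piPred_leastCounterexamples {α : Type} [Primcodable α] {n : ℕ} {q : α → ℕ → ℕ → Prop}
    (hq : PiPred n fun x : (α × ℕ) × ℕ => q x.1.1 x.1.2 x.2) {b : α → List ℕ}
    (hb : Computable b) : PiPred (n + 1) fun a => LeastCounterexamples (q a) (b a) := by
  have hq' : PiPred (n + 1) fun x : (α × ℕ) × ℕ => ¬ q x.1.1 x.1.2 x.2 :=
    SigmaPred.toPi (n := n) (SigmaPred.not hq) n.lt_succ_self
  refine PiPred.and (PiPred.all (hq'.comp (f := fun x : α × ℕ => ((x.1, (b x.1).length), x.2))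
    (by fun_prop))) (PiPred.all (PiPred.imp (ComputablePred.lt (by fun_prop) (by fun_prop)).sigma
    (PiPred.and ?_ (PiPred.all (PiPred.imp
      (ComputablePred.lt (by fun_prop) (by fun_prop)).sigma hq')))))
  exact (hq.comp (f := fun x : α × ℕ => (x, (b x.1).getD x.2 0)) (by fun_prop)).mono n.le_succ

/-- The complement of `A` has the form ∀ t, ∃ k, Π⁰₄. With the least `k` coded uniquely by
`LeastCounterexamples`, it says that infinitely many lists satisfy the Π⁰₄ condition `N x`. So `x ∈
A` means that almost all numbers satisfy the Σ⁰₄ condition `¬ N x`, as `exists_reduction` requires.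
-/
theorem manyOneReducible_weaklySpHomogeneousIndices {A : Set ℕ} (hA : IsSigmaZero 6 A) :
    (fun x => x ∈ A) ≤₀ fun x => x ∈ weaklySpHomogeneousIndices := by
  obtain ⟨q₁, ⟨q₂, ⟨q₃, hq₃, e₃⟩, e₂⟩, e₁⟩ := isSigmaZero_iff.1 hA
  let P : ℕ → ℕ → List ℕ → Prop := fun x t => LeastCounterexamples fun k y => q₃ (((x, t), k), y)
  let N : ℕ → List (List ℕ) → Prop := fun x l => ∀ t, t < l.length → P x t (l.getD t [])
  have hN : PiPred 4 fun x : ℕ × ℕ => N x.1 (Denumerable.ofNat (List (List ℕ)) x.2) := by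
    have hl : Computable fun x : (ℕ × ℕ) × ℕ => Denumerable.ofNat (List (List ℕ)) x.1.2 :=
      (Computable.ofNat _).comp (by fun_prop)
    refine PiPred.all (PiPred.imp (ComputablePred.lt (by fun_prop) (by fun_prop)).sigma ?_)
    exact piPred_leastCounterexamples (α := (ℕ × ℕ) × ℕ)
      (q := fun z k y => q₃ (((z.1.1, z.2), k), y))
      (PiPred.comp (n := 3) (p := q₃) hq₃
        (f := fun w : (((ℕ × ℕ) × ℕ) × ℕ) × ℕ => (((w.1.1.1.1, w.1.1.2), w.1.2), w.2))
        (by fun_prop))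
      (b := fun z => (Denumerable.ofNat (List (List ℕ)) z.1.2).getD z.2 []) (by fun_prop)
  obtain ⟨f, hf, H⟩ := exists_reduction
    (T := fun x i => ¬ N x (Denumerable.ofNat (List (List ℕ)) i)) hN
  refine ⟨f, hf, fun x => ?_⟩
  have hq₂ : ∀ w, q₂ w ↔ ∀ y, ¬ q₃ (w, y) := fun w => by rw [← not_exists, ← e₃, not_not]
  have hx : x ∉ A ↔ ∀ t, ∃ b, P x t b := by
    refine (not_congr (e₁ x)).trans (not_exists.trans (forall_congr' fun t => ?_))
    refine (e₂ (x, t)).trans (Iff.trans ?_ exists_leastCounterexamples_iff.symm)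
    simp only [hq₂]
  have hfr : (∃ᶠ i in atTop, N x (Denumerable.ofNat (List (List ℕ)) i)) ↔ {l | N x l}.Infinite := by
    rw [Nat.frequently_atTop_iff_infinite]
    refine (Set.infinite_image_iff
      (Denumerable.eqv (List (List ℕ))).symm.injective.injOn).symm.trans ?_
    refine iff_of_eq (congrArg Set.Infinite ?_)
    exact Set.image_preimage_eq {l | N x l} (Denumerable.eqv (List (List ℕ))).symm.surjective
  show x ∈ A ↔ f x ∈ weaklySpHomogeneousIndices
  rw [(H x).2, ← not_frequently, hfr, ← not_iff_not, hx, not_not]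
  exact (infinite_setOf_forall_getD_iff (P := P x) (fun t b b' => LeastCounterexamples.unique) []).symm

end Reductions

theorem mainTheorem3 :
    IsCompleteFor (IsPiZero 5) spHomogeneousIndices ∧
      IsCompleteFor (IsSigmaZero 6) weaklySpHomogeneousIndices := by
  exact ⟨⟨isPiZero_spHomogeneousIndices, fun _ => manyOneReducible_spHomogeneousIndices⟩,
    ⟨isSigmaZero_weaklySpHomogeneousIndices, fun _ => manyOneReducible_weaklySpHomogeneousIndices⟩⟩
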